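/- **Language and theory.** Let $\mathcal L$ be the language of arithmetic with relation symbols $=,<$ and a function constant for (each definition of) each elementary recursive function. A formula of $\mathcal L$ is *bounded* if all its quantifiers are bounded. An ${\sf Acc}$-*operator* is an $X$-positive formula $$\varphi(X,x)\equiv\forall y\,(\theta_0(x,y)\to t_0(x,y)\in X)$$ with a bounded formula $\theta_0$ and a term $t_0$ of $\mathcal L$. Let $\mathcal L({\sf Acc})$ be $\mathcal L$ together with a unary predicate constant $R_\varphi$ for each ${\sf Acc}$-operator $\varphi$. $Acc$ is the class of the formulas $\sigma(x)\equiv\forall y\,(\theta_0(x,y)\to t_0(x,y)\in R)$, where $R$ is one of these predicate constants, $\theta_0$ is a bounded formula and $t_0$ a term of $\mathcal L$, possibly with further variables as parameters. The theory $Acc\text{-}{\rm ID}({\sf Acc})$ in classical first-order logic with equality has the following axioms (their free variables are universally quantified): 1. the axioms for $<$, the defining axioms of the function constants, and complete induction $\theta(0)\land\forall x(\theta(x)\to\theta(x+1))\to\forall y\,\theta(y)$ for bounded formulas $\theta$ of $\mathcal L$ (that is, elementary recursive arithmetic ${\sf EA}$); 2. complete induction for each formula in $Acc$; 3. $\forall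 x\,[\varphi(R_\varphi,x)\to R_\varphi(x)]$ for each ${\sf Acc}$-operator $\varphi$; 4. $\forall u\,[R_\varphi(u)\to\forall x(\varphi(\sigma,x)\to\sigma(x))\to\sigma(u)]$ for each ${\sf Acc}$-operator $\varphi$ and each $\sigma$ in $Acc$. **Ordinal notations.** The notation system $OT'(\vartheta)$ consists of $0$ and the formal sums $$\Omega^{\alpha_1}\vartheta(\beta_1)+\cdots+\Omega^{\alpha_n}\vartheta(\beta_n)\qquad(n\ge 1,\ \alpha_i,\beta_i\in OT'(\vartheta)),$$ in which the pairs $(\alpha_i,\vartheta(\beta_i))$ do not increase lexicographically. Here $\vartheta(\beta)$ is identified with $\Omega^{0}\vartheta(\beta)$, and the summands with one exponent $\alpha$ make up the term $\Omega^{\alpha}\beta$ of the $\Omega$-normal form, with a coefficient $0<\beta<\Omega$ that is a sum of terms $\vartheta(\cdot)$. Put $K(0)=\emptyset$ and $K(\sum_i\Omega^{\alpha_i}\vartheta(\beta_i))=\bigcup_i\big(K(\alpha_i)\cup\{\vartheta(\beta_i)\}\big)$. The least element is $0$, sums are compared lexicographically by their sequences of pairs $(\alpha_i,\vartheta(\beta_i))$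 (a proper initial segment being smaller), and $$\vartheta(\alpha)<\vartheta(\beta)\iff[\alpha<\beta\land\forall\gamma\in K(\alpha)\,(\gamma<\vartheta(\beta))]\lor\exists\delta\in K(\beta)\,(\vartheta(\alpha)\le\delta).$$ Let $1=\vartheta(0)$, and let $\Omega\cdot k=\Omega^{1}\vartheta(0)+\cdots+\Omega^{1}\vartheta(0)$ with $k$ summands. Terms are coded by natural numbers through the iterated pairing of $\alpha_1,\beta_1$ and the rest of the sum. The order $<$ on codes is given in $\mathcal L$ by the function constant for its characteristic function, defined by the recursion above. Let $W$ be the predicate constant $R_\varphi$ for the ${\sf Acc}$-operator $\varphi(X,x)\equiv\forall y\,(y<x\to y\in X)$ with this order $<$; it expresses the accessible part of $<$. **Lemma.** For each $k<\omega$, $$Acc\text{-}{\rm ID}({\sf Acc})\vdash\forall\beta\,[\beta<\vartheta(\Omega\cdot k)\to\beta\in W].$$ -/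

import Mathlib

open FirstOrder FirstOrder.Language

namespace WeakID

/-! ### Elementary recursive functions

Function constants for the elementary recursive functions: basic functions, composition and
limited (course-of-values) recursion. Every constant is a *definition* of a function, so that
its defining axiom can be read off from it. -/

/-- Definitions of elementary recursive functions, indexed by arity. The basic functions are
`0`, `x + 1`, `x + y`, `x * y`, `x - y` (truncated), `2 ^ x`, the pairing function `Nat.pair` with
its two inverses, and the projections. `comp f g` is `f(g₁(x), …, gₘ(x))`.
`crec p h j` is the function `f(z, x)` given by the limited course-of-values recursion
`f(z, x) = min (h(z, x, v₁, …, vₖ)) (j(z, x))`, where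
`vᵢ = f(pᵢ(z, x), x)` if `pᵢ(z, x) < z`, and `vᵢ = 0` otherwise. With `k = 1` and `p₁(z, x) = z - 1`
this is the usual limited recursion of the Grzegorczyk class of elementary functions. -/
inductive ElemFn : ℕ → Type
  | zero : ElemFn 0
  | succ : ElemFn 1
  | add : ElemFn 2
  | mul : ElemFn 2
  | monus : ElemFn 2
  | exp2 : ElemFn 1
  | pair : ElemFn 2
  | fst : ElemFn 1
  | snd : ElemFn 1
  | proj {n : ℕ} (i : Fin n) : ElemFn n
  | comp {m n : ℕ} (f : ElemFn m) (g : Fin m → ElemFn n) : ElemFn n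
  | crec {n k : ℕ} (p : Fin k → ElemFn (n + 1)) (h : ElemFn (n + 1 + k)) (j : ElemFn (n + 1)) :
      ElemFn (n + 1)

/-- The function on `ℕ` defined by limited course-of-values recursion. -/
def limRec {n k : ℕ} (p : Fin k → (Fin (n + 1) → ℕ) → ℕ) (h : (Fin (n + 1 + k) → ℕ) → ℕ)
    (j : (Fin (n + 1) → ℕ) → ℕ) (xs : Fin n → ℕ) (z : ℕ) : ℕ :=
  min (h (Fin.append (Fin.cons z xs : Fin (n + 1) → ℕ)
      (fun i => if p i (Fin.cons z xs) < z then limRec p h j xs (p i (Fin.cons z xs)) else 0)))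
    (j (Fin.cons z xs))
termination_by z

/-- The standard interpretation of a definition of an elementary recursive function. -/
def ElemFn.eval : {n : ℕ} → ElemFn n → (Fin n → ℕ) → ℕ
  | _, .zero, _ => 0
  | _, .succ, xs => xs 0 + 1
  | _, .add, xs => xs 0 + xs 1
  | _, .mul, xs => xs 0 * xs 1
  | _, .monus, xs => xs 0 - xs 1
  | _, .exp2, xs => 2 ^ xs 0
  | _, .pair, xs => Nat.pair (xs 0) (xs 1)
  | _, .fst, xs => (Nat.unpair (xs 0)).1
  | _, .snd, xs => (Nat.unpair (xs 0)).2
  | _, .proj i, xs => xs i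
  | _, .comp f g, xs => f.eval (fun i => (g i).eval xs)
  | _, .crec p h j, xs =>
      limRec (fun i => (p i).eval) h.eval j.eval (Fin.tail xs) (xs 0)

namespace ElemFn

/-- `f(a)` -/
def app₁ {n : ℕ} (f : ElemFn 1) (a : ElemFn n) : ElemFn n := comp f ![a]

/-- `f(a, b)` -/
def app₂ {n : ℕ} (f : ElemFn 2) (a b : ElemFn n) : ElemFn n := comp f ![a, b]

/-- The constant `0` as an `n`-ary function. -/
def zeroF {n : ℕ} : ElemFn n := comp zero ![]

/-- The constant `1` as an `n`-ary function. -/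
def oneF {n : ℕ} : ElemFn n := app₁ succ zeroF

/-- Truth values: `0` is false and `1` is true. -/
def notF {n : ℕ} (a : ElemFn n) : ElemFn n := app₂ monus oneF a

/-- `1` if `a > 0`, else `0`. -/
def posF {n : ℕ} (a : ElemFn n) : ElemFn n := notF (notF a)

def andF {n : ℕ} (a b : ElemFn n) : ElemFn n := app₂ mul a b

def orF {n : ℕ} (a b : ElemFn n) : ElemFn n := posF (app₂ add a b)

/-- `1` if `a = b`, else `0`. -/
def eqF {n : ℕ} (a b : ElemFn n) : ElemFn n := notF (app₂ add (app₂ monus a b) (app₂ monus b a))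

end ElemFn

/-! ### The ordinal notation system based on `0, Ω, +, ϑ` -/

/-- Terms for ordinals: `oadd a b r` denotes `Ω ^ a * ϑ(b) + r`. In normal form, an ordinal is a
sum `Ω ^ a₁ * ϑ(b₁) + … + Ω ^ aₙ * ϑ(bₙ)` whose exponent-coefficient pairs do not increase. Summands
with the same exponent `a` make up one term `Ω ^ a * β`, where `β = ϑ(b) + ϑ(b') + … < Ω`. -/
inductive OT : Type
  | zero : OT
  | oadd (a b r : OT) : OT

namespace OT

/-- The countable ordinal `ϑ(b) = Ω ^ 0 * ϑ(b) + 0`. -/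
def theta (b : OT) : OT := oadd zero b zero

/-- The finite set `K(x)`, with the countable coefficients split into their additively
indecomposable summands `ϑ(b)`. -/
def K : OT → Set OT
  | zero => ∅
  | oadd a b r => K a ∪ {theta b} ∪ K r

/-- The order on ordinal terms. The rules for `oadd` compare lexicographically the exponents, the
coefficients and the remainders, the last two rules are those for `ϑ(α) < ϑ(β)`:
`[α < β ∧ ∀ γ ∈ K(α), γ < ϑ(β)] ∨ ∃ δ ∈ K(β), ϑ(α) ≤ δ`. -/
inductive Lt : OT → OT → Prop
  | zero_lt (a b r) : Lt zero (oadd a b r)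
  | exp {a a'} (b r b' r') : Lt a a' → Lt (oadd a b r) (oadd a' b' r')
  | coeff (a) {b b'} (r r') : Lt (theta b) (theta b') → Lt (oadd a b r) (oadd a b' r')
  | tail (a b) {r r'} : Lt r r' → Lt (oadd a b r) (oadd a b r')
  | theta_arg {α β} : Lt α β → (∀ γ ∈ K α, Lt γ (theta β)) → Lt (theta α) (theta β)
  | theta_eq {α β} : theta α ∈ K β → Lt (theta α) (theta β)
  | theta_coeff {α β δ} : δ ∈ K β → Lt (theta α) δ → Lt (theta α) (theta β)

/-- `r` is zero or its leading summand is at most `Ω ^ a * ϑ(b)`. -/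
def HeadLe (a b : OT) : OT → Prop
  | zero => True
  | oadd a' b' _ => Lt a' a ∨ (a' = a ∧ (b' = b ∨ Lt (theta b') (theta b)))

/-- Terms in normal form, i.e. the elements of the notation system. -/
def NF : OT → Prop
  | zero => True
  | oadd a b r => NF a ∧ NF b ∧ NF r ∧ HeadLe a b r

/-- `1 = ϑ(0)` -/
def one : OT := theta zero

/-- `Ω * k = Ω ^ 1 * 1 + … + Ω ^ 1 * 1` with `k` summands. -/
def omegaMul : ℕ → OT
  | 0 => zero
  | k + 1 => oadd one zero (omegaMul k)

/-- The encoding of terms as natural numbers. -/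
def code : OT → ℕ
  | zero => 0
  | oadd a b r => Nat.pair a.code (Nat.pair b.code r.code) + 1

end OT

/-! ### The order of the notation system as an elementary recursive relation -/

namespace ElemFn

/-- The code of `a` from the code of `Ω ^ a * ϑ(b) + r`. -/
def expF {n : ℕ} (x : ElemFn n) : ElemFn n := app₁ fst (app₂ monus x oneF)

/-- The code of `b` from the code of `Ω ^ a * ϑ(b) + r`. -/
def coeffF {n : ℕ} (x : ElemFn n) : ElemFn n := app₁ fst (app₁ snd (app₂ monus x oneF))

/-- The code of `r` from the code of `Ω ^ a * ϑ(b) + r`. -/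
def tailF {n : ℕ} (x : ElemFn n) : ElemFn n := app₁ snd (app₁ snd (app₂ monus x oneF))

/-- The components of a triple of truth values, see `cmp`. -/
def ltF {n : ℕ} (v : ElemFn n) : ElemFn n := app₁ fst v
def allKF {n : ℕ} (v : ElemFn n) : ElemFn n := app₁ fst (app₁ snd v)
def exKF {n : ℕ} (v : ElemFn n) : ElemFn n := app₁ snd (app₁ snd v)

/-- The truth value of `ϑ(x) < ϑ(y)`, from the triple of `x` and `y`. -/
def thetaLtF {n : ℕ} (v : ElemFn n) : ElemFn n := orF (andF (ltF v) (allKF v)) (exKF v)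

/-- `cmp ⟨x, y⟩` is the triple `⟨t₁, ⟨t₂, t₃⟩⟩` of the truth values of
`x < y`, of `∀ γ ∈ K(x), γ < ϑ(y)` and of `∃ δ ∈ K(y), ϑ(x) ≤ δ`.
With `x = Ω ^ a * ϑ(b) + r` and `y = Ω ^ a' * ϑ(b') + r'`, it is defined from the triples of
`⟨a, a'⟩, ⟨b, b'⟩, ⟨r, r'⟩, ⟨a, y⟩, ⟨b, y⟩, ⟨r, y⟩, ⟨x, a'⟩, ⟨x, b'⟩, ⟨x, r'⟩`. -/
def cmp : ElemFn 1 :=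
  crec (n := 0) (k := 9)
    (let x : ElemFn 1 := app₁ fst (proj 0)
     let y : ElemFn 1 := app₁ snd (proj 0)
     ![app₂ pair (expF x) (expF y), app₂ pair (coeffF x) (coeffF y), app₂ pair (tailF x) (tailF y),
       app₂ pair (expF x) y, app₂ pair (coeffF x) y, app₂ pair (tailF x) y,
       app₂ pair x (expF y), app₂ pair x (coeffF y), app₂ pair x (tailF y)])
    (let x : ElemFn 10 := app₁ fst (proj 0)
     let y : ElemFn 10 := app₁ snd (proj 0)
     app₂ pair
      (andF (posF y) (orF (notF x)
        (orF (ltF (proj 1)) (andF (eqF (expF x) (expF y))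
          (orF (thetaLtF (proj 2)) (andF (eqF (coeffF x) (coeffF y)) (ltF (proj 3))))))))
      (app₂ pair
        (orF (notF x) (andF (allKF (proj 4)) (andF (thetaLtF (proj 5)) (allKF (proj 6)))))
        (andF (posF y) (orF (exKF (proj 7))
          (orF (orF (eqF x (coeffF y)) (thetaLtF (proj 8))) (exKF (proj 9)))))))
    (app₂ pair oneF (app₂ pair oneF oneF))

/-- `cmp ⟨x, y⟩` as a function of `x` and `y`. -/
def cmpF {n : ℕ} (x y : ElemFn n) : ElemFn n := app₁ cmp (app₂ pair x y)

/-- The characteristic function of the set of codes of terms in normal form. -/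
def nf : ElemFn 1 :=
  crec (n := 0) (k := 3) ![expF (proj 0), coeffF (proj 0), tailF (proj 0)]
    (let x : ElemFn 4 := proj 0
     let a := expF x
     let b := coeffF x
     let r := tailF x
     orF (notF x) (andF (proj 1) (andF (proj 2) (andF (proj 3)
      (orF (notF r) (orF (ltF (cmpF (expF r) a))
        (andF (eqF (expF r) a) (orF (eqF (coeffF r) b) (thetaLtF (cmpF (coeffF r) b))))))))))
    oneF

/-- The characteristic function of the relation `x < y` on the codes of terms in normal form. -/
def prec : ElemFn 2 :=
  andF (andF (app₁ nf (proj 0)) (app₁ nf (proj 1))) (ltF (cmpF (proj 0) (proj 1)))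

end ElemFn

/-! ### The function constant `prec` denotes the order of the notation system

The theorem `prec_code` at the end of this section states that, in the standard interpretation,
`prec` is the order `OT.Lt` on the codes of terms in normal form. -/

namespace Encoding

section
open ElemFn
set_option linter.unusedSimpArgs false
set_option linter.unusedVariables false

section
variable {n : ℕ} (a b : ElemFn n) (xs : Fin n → ℕ)
theorem ev_fst : (app₁ fst a).eval xs = (Nat.unpair (a.eval xs)).1 := rfl
theorem ev_snd : (app₁ snd a).eval xs = (Nat.unpair (a.eval xs)).2 := rfl
theorem ev_pair : (app₂ pair a b).eval xs = Nat.pair (a.eval xs) (b.eval xs) := rfl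
theorem ev_add : (app₂ add a b).eval xs = a.eval xs + b.eval xs := rfl
theorem ev_monus : (app₂ monus a b).eval xs = a.eval xs - b.eval xs := rfl
theorem ev_zero : (zeroF : ElemFn n).eval xs = 0 := rfl
theorem ev_one : (oneF : ElemFn n).eval xs = 1 := rfl
theorem ev_not : (notF a).eval xs = 1 - a.eval xs := rfl
theorem ev_pos : (posF a).eval xs = 1 - (1 - a.eval xs) := rfl
theorem ev_and : (andF a b).eval xs = a.eval xs * b.eval xs := rfl
theorem ev_or : (orF a b).eval xs = 1 - (1 - (a.eval xs + b.eval xs)) := rfl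
theorem ev_eq : (eqF a b).eval xs = 1 - ((a.eval xs - b.eval xs) + (b.eval xs - a.eval xs)) := rfl
theorem ev_proj (i : Fin n) : (proj i).eval xs = xs i := rfl
theorem ev_exp : (expF a).eval xs = (Nat.unpair (a.eval xs - 1)).1 := rfl
theorem ev_coeff : (coeffF a).eval xs = (Nat.unpair (Nat.unpair (a.eval xs - 1)).2).1 := rfl
theorem ev_tail : (tailF a).eval xs = (Nat.unpair (Nat.unpair (a.eval xs - 1)).2).2 := rfl
end

def tl (v : ℕ) : ℕ := 1 - (1 - ((Nat.unpair v).1 * (Nat.unpair (Nat.unpair v).2).1 + (Nat.unpair (Nat.unpair v).2).2))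

theorem ev_thetaLt {n} (a : ElemFn n) (xs : Fin n → ℕ) : (thetaLtF a).eval xs = tl (a.eval xs) := rfl

def C (x y : ℕ) : ℕ := cmp.eval ![Nat.pair x y]
theorem ev_cmp {n} (a b : ElemFn n) (xs : Fin n → ℕ) : (cmpF a b).eval xs = C (a.eval xs) (b.eval xs) := by
  show cmp.eval _ = cmp.eval _
  congr 1; funext i; fin_cases i; rfl

def eA (x : ℕ) := (Nat.unpair (x - 1)).1
def eB (x : ℕ) := (Nat.unpair (Nat.unpair (x-1)).2).1
def eR (x : ℕ) := (Nat.unpair (Nat.unpair (x-1)).2).2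

def T1 (v : ℕ) : ℕ := (Nat.unpair v).1
def T2 (v : ℕ) : ℕ := (Nat.unpair (Nat.unpair v).2).1
def T3 (v : ℕ) : ℕ := (Nat.unpair (Nat.unpair v).2).2
def orN (a b : ℕ) := 1 - (1 - (a+b))
def eqN (a b : ℕ) := 1 - ((a-b)+(b-a))
def gd (n m : ℕ) : ℕ := if m < n then cmp.eval ![m] else 0

def stepC (g : ℕ → ℕ) (x y : ℕ) : ℕ :=
  min (Nat.pair
      ((1-(1-y)) * (orN (1-x)
        (orN (T1 (g (Nat.pair (eA x) (eA y)))) ((eqN (eA x) (eA y)) *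
          (orN (tl (g (Nat.pair (eB x) (eB y)))) ((eqN (eB x) (eB y)) * (T1 (g (Nat.pair (eR x) (eR y))))))))))
      (Nat.pair
        (orN (1-x) ((T2 (g (Nat.pair (eA x) y))) * ((tl (g (Nat.pair (eB x) y))) * (T2 (g (Nat.pair (eR x) y))))))
        ((1-(1-y)) * (orN (T3 (g (Nat.pair x (eA y))))
          (orN (orN (eqN x (eB y)) (tl (g (Nat.pair x (eB y))))) (T3 (g (Nat.pair x (eR y)))))))))
   (Nat.pair 1 (Nat.pair 1 1))

theorem C_eq0 (n : ℕ) : cmp.eval ![n] = stepC (gd n) (Nat.unpair n).1 (Nat.unpair n).2 := by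
  have key : ∀ (z : ℕ), cmp.eval ![z] = limRec _ _ _ (Fin.tail ![z]) z := fun z => rfl
  have hC : ∀ z (t : Fin 0 → ℕ), limRec _ _ _ t z = cmp.eval ![z] := fun z t => by
    rw [key, Subsingleton.elim t]
  rw [key, limRec]
  simp only [hC]
  rfl

theorem C_eq (x y : ℕ) : C x y = stepC (gd (Nat.pair x y)) x y := by
  unfold C; rw [C_eq0]; simp

open OT

def oc (a b r : ℕ) : ℕ := Nat.pair a (Nat.pair b r) + 1
theorem eA_oc (a b r) : eA (oc a b r) = a := by simp [eA, oc]
theorem eB_oc (a b r) : eB (oc a b r) = b := by simp [eB, oc]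
theorem eR_oc (a b r) : eR (oc a b r) = r := by simp [eR, oc]
theorem lt_a (a b r) : a < oc a b r := by
  have := Nat.left_le_pair a (Nat.pair b r); unfold oc; omega
theorem lt_b (a b r) : b < oc a b r := by
  have := Nat.right_le_pair a (Nat.pair b r); have := Nat.left_le_pair b r; unfold oc; omega
theorem lt_r (a b r) : r < oc a b r := by
  have := Nat.right_le_pair a (Nat.pair b r); have := Nat.right_le_pair b r; unfold oc; omega
theorem pp {x y x' y'} (h : x ≤ x') (h' : y ≤ y') (h2 : x < x' ∨ y < y') : Nat.pair x y < Nat.pair x' y' := by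
  rcases h2 with h2 | h2
  · rcases h'.eq_or_lt with rfl | h3
    · exact Nat.pair_lt_pair_left _ h2
    · exact (Nat.pair_lt_pair_left _ h2).trans (Nat.pair_lt_pair_right _ h3)
  · rcases h.eq_or_lt with rfl | h3
    · exact Nat.pair_lt_pair_right _ h2
    · exact (Nat.pair_lt_pair_left _ h3).trans (Nat.pair_lt_pair_right _ h2)
theorem gd_C {x y x' y'} (h : x ≤ x') (h' : y ≤ y') (h2 : x < x' ∨ y < y') :
    gd (Nat.pair x' y') (Nat.pair x y) = C x y := by
  rw [gd, if_pos (pp h h' h2)]; rfl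

theorem code_inj {x y : OT} (h : x.code = y.code) : x = y := by
  induction x generalizing y with
  | zero => cases y with
    | zero => rfl
    | oadd => simp [code] at h
  | oadd a b r iha ihb ihr => cases y with
    | zero => simp [code] at h
    | oadd => simp [code] at h; rw [iha h.1, ihb h.2.1, ihr h.2.2]

theorem Lt_theta {α β : OT} : Lt (theta α) (theta β) ↔
    (Lt α β ∧ ∀ γ ∈ K α, Lt γ (theta β)) ∨ ∃ δ ∈ K β, theta α = δ ∨ Lt (theta α) δ := by
  constructor
  · intro h
    generalize hx : theta α = x at h
    generalize hy : theta β = y at h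
    induction h with
    | zero_lt => cases hx
    | exp b r b' r' h => cases hx; cases hy; cases h
    | coeff a r r' h ih => cases hx; cases hy; exact ih rfl rfl
    | tail a b h => cases hx; cases hy; cases h
    | theta_arg h h' => cases hx; cases hy; exact .inl ⟨h, h'⟩
    | theta_eq h => cases hx; cases hy; exact .inr ⟨_, h, .inl rfl⟩
    | theta_coeff h h' => cases hx; cases hy; exact .inr ⟨_, h, .inr h'⟩
  · rintro (⟨h, h'⟩ | ⟨δ, h, rfl | h'⟩)
    · exact .theta_arg h h'
    · exact .theta_eq h
    · exact .theta_coeff h h'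

theorem Lt_oadd {a b r a' b' r' : OT} : Lt (oadd a b r) (oadd a' b' r') ↔
    Lt a a' ∨ (a = a' ∧ (Lt (theta b) (theta b') ∨ (b = b' ∧ Lt r r'))) := by
  constructor
  · intro h
    cases h with
    | exp _ _ _ _ h => exact .inl h
    | coeff _ _ _ h => exact .inr ⟨rfl, .inl h⟩
    | tail _ _ h => exact .inr ⟨rfl, .inr ⟨rfl, h⟩⟩
    | theta_arg h h' => exact .inr ⟨rfl, .inl (.theta_arg h h')⟩
    | theta_eq h => exact .inr ⟨rfl, .inl (.theta_eq h)⟩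
    | theta_coeff h h' => exact .inr ⟨rfl, .inl (.theta_coeff h h')⟩
  · rintro (h | ⟨rfl, h | ⟨rfl, h⟩⟩)
    · exact .exp _ _ _ _ h
    · exact .coeff _ _ _ h
    · exact .tail _ _ h

noncomputable def tv (p : Prop) : ℕ := by classical exact if p then 1 else 0
theorem tv_le (p) : tv p ≤ 1 := by unfold tv; split <;> omega
theorem tv_one (p) : tv p = 1 ↔ p := by unfold tv; split <;> simp_all
theorem tvF : tv False = 0 := by simp [tv]
theorem tvT : tv True = 1 := by simp [tv]
theorem or_tv (p q) : orN (tv p) (tv q) = tv (p ∨ q) := by unfold tv orN; split <;> split <;> simp_all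
theorem and_tv (p q) : (tv p) * (tv q) = tv (p ∧ q) := by unfold tv; split <;> split <;> simp_all
theorem eq_tv (a b) : eqN a b = tv (a = b) := by unfold tv eqN; split <;> omega
theorem not_tv (a) : 1 - a = tv (a = 0) := by unfold tv; split <;> omega
theorem pos_tv (a) : 1 - (1 - a) = tv (a ≠ 0) := by unfold tv; split <;> omega

def A2 (x y : OT) : Prop := ∀ γ ∈ K x, Lt γ (theta y)
def A3 (x y : OT) : Prop := ∃ δ ∈ K y, theta x = δ ∨ Lt (theta x) δ
noncomputable def trip (x y : OT) : ℕ := Nat.pair (tv (Lt x y)) (Nat.pair (tv (A2 x y)) (tv (A3 x y)))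
theorem T1_t (x y) : T1 (trip x y) = tv (Lt x y) := by simp [T1, trip]
theorem T2_t (x y) : T2 (trip x y) = tv (A2 x y) := by simp [T2, trip]
theorem T3_t (x y) : T3 (trip x y) = tv (A3 x y) := by simp [T3, trip]
theorem tl_t (x y) : tl (trip x y) = tv (Lt (theta x) (theta y)) := by
  show orN (T1 _ * T2 _) (T3 _) = _
  rw [T1_t, T2_t, T3_t, and_tv, or_tv, Lt_theta]; rfl
theorem A2_oadd (a b r y) : A2 (oadd a b r) y ↔ A2 a y ∧ (Lt (theta b) (theta y)) ∧ A2 r y := by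
  simp only [A2, K, Set.mem_union, Set.mem_singleton_iff]
  constructor
  · intro h; exact ⟨fun γ hγ => h γ (.inl (.inl hγ)), h _ (.inl (.inr rfl)), fun γ hγ => h γ (.inr hγ)⟩
  · rintro ⟨h1, h2, h3⟩ γ ((h | rfl) | h)
    exacts [h1 _ h, h2, h3 _ h]
theorem A3_oadd (x a b r) : A3 x (oadd a b r) ↔ A3 x a ∨ ((x = b ∨ Lt (theta x) (theta b)) ∨ A3 x r) := by
  have : theta x = theta b ↔ x = b := by simp [theta]
  simp only [A3, K, Set.mem_union, Set.mem_singleton_iff]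
  constructor
  · rintro ⟨δ, (h | rfl) | h, h'⟩
    · exact .inl ⟨δ, h, h'⟩
    · rw [this] at h'; exact .inr (.inl h')
    · exact .inr (.inr ⟨δ, h, h'⟩)
  · rintro (⟨δ, h, h'⟩ | h | ⟨δ, h, h'⟩)
    · exact ⟨δ, .inl (.inl h), h'⟩
    · rw [← this] at h; exact ⟨_, .inl (.inr rfl), h⟩
    · exact ⟨δ, .inr h, h'⟩
theorem A2_zero (y) : A2 zero y ↔ True := by simp [A2, K]
theorem A3_zero (x) : A3 x zero ↔ False := by simp [A3, K]
theorem Lt_zero (x) : Lt x zero ↔ False := by simp; intro h; cases h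
theorem zero_Lt (a b r) : Lt zero (oadd a b r) ↔ True := by simp; exact .zero_lt ..

theorem code_oadd (a b r) : (oadd a b r).code = oc a.code b.code r.code := rfl
theorem code_eq (x y : OT) : x.code = y.code ↔ x = y := ⟨code_inj, fun h => h ▸ rfl⟩

theorem trip_min (x y) : min (trip x y) (Nat.pair 1 (Nat.pair 1 1)) = trip x y := by
  unfold trip tv; split <;> split <;> split <;> norm_num [Nat.pair]

theorem C_code (x y : OT) : C x.code y.code = trip x y := by
  generalize hn : Nat.pair x.code y.code = n
  induction n using Nat.strong_induction_on generalizing x y with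
  | _ n ih =>
    have IH : ∀ x' y' : OT, x'.code ≤ x.code → y'.code ≤ y.code → (x'.code < x.code ∨ y'.code < y.code) →
        gd (Nat.pair x.code y.code) (Nat.pair x'.code y'.code) = trip x' y' := by
      intro x' y' h h' h2
      rw [gd_C h h' h2]
      exact ih _ (hn ▸ pp h h' h2) _ _ rfl
    clear ih hn
    rw [C_eq, stepC, ← trip_min]
    refine congrArg (fun t => min t (Nat.pair 1 (Nat.pair 1 1))) ?_
    cases x with
    | zero => cases y with
      | zero => simp [code, trip, A2_zero, A3_zero, Lt_zero, orN, tv]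
      | oadd a b r =>
        have ha := lt_a a.code b.code r.code
        have hb := lt_b a.code b.code r.code
        have hr := lt_r a.code b.code r.code
        rw [code_oadd] at *
        simp only [eA_oc, eB_oc, eR_oc]
        rw [IH zero a (by simp) (by omega) (by omega), IH zero b (by simp) (by omega) (by omega),
          IH zero r (by simp) (by omega) (by omega)]
        have h0 : 1 - (1 - oc a.code b.code r.code) = tv True := by rw [tvT]; omega
        have h1 : 1 - zero.code = tv True := by rw [tvT]; rfl
        simp only [T1_t, T2_t, T3_t, tl_t, eq_tv, code_eq, h0, h1]
        have h2 : ∀ m, orN (tv True) m = tv True := by intro m; rw [tvT]; unfold orN; omega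
        rw [h2, h2]
        simp only [or_tv, and_tv, trip, A2_zero, zero_Lt, A3_oadd]
        simp
    | oadd a b r =>
      have ha := lt_a a.code b.code r.code
      have hb := lt_b a.code b.code r.code
      have hr := lt_r a.code b.code r.code
      have h0 : oc a.code b.code r.code ≠ 0 := by omega
      cases y with
      | zero =>
        rw [code_oadd] at *
        simp only [eA_oc, eB_oc, eR_oc]
        rw [IH a zero (by omega) (by simp) (by omega), IH b zero (by omega) (by simp) (by omega),
          IH r zero (by omega) (by simp) (by omega)]
        simp only [T1_t, T2_t, T3_t, tl_t, code_eq]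
        have h2 : 1 - oc a.code b.code r.code = tv False := by rw [tvF]; omega
        have h1 : 1 - (1 - zero.code) = 0 := by rfl
        simp only [h1, h2, or_tv, and_tv, trip, A2_oadd, Lt_zero, A3_zero, Nat.zero_mul, false_or]
        simp only [tvF]
      | oadd a' b' r' =>
        have ha' := lt_a a'.code b'.code r'.code
        have hb' := lt_b a'.code b'.code r'.code
        have hr' := lt_r a'.code b'.code r'.code
        have h0' : oc a'.code b'.code r'.code ≠ 0 := by omega
        rw [code_oadd a b r, code_oadd a' b' r'] at *
        simp only [eA_oc, eB_oc, eR_oc]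
        rw [IH a a' (by omega) (by omega) (by omega), IH b b' (by omega) (by omega) (by omega),
          IH r r' (by omega) (by omega) (by omega)]
        have IH1 := IH (oadd a b r)
        have IH2 := fun x => IH x (oadd a' b' r')
        rw [code_oadd] at IH1
        rw [code_oadd a' b' r'] at IH2
        rw [IH1 a' (by omega) (by omega) (by omega), IH1 b' (by omega) (by omega) (by omega),
          IH1 r' (by omega) (by omega) (by omega), IH2 a (by omega) (by omega) (by omega),
          IH2 b (by omega) (by omega) (by omega), IH2 r (by omega) (by omega) (by omega)]
        simp only [T1_t, T2_t, T3_t, tl_t, eq_tv, pos_tv, not_tv, ← code_oadd, code_eq]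
        have h1 : (oadd a b r).code ≠ 0 := h0
        have h1' : (oadd a' b' r').code ≠ 0 := h0'
        simp only [or_tv, and_tv, trip, A2_oadd, Lt_oadd, A3_oadd, h1, h1', ne_eq, not_false_eq_true, true_and, false_or]
        simp [tvF]
def N (x : ℕ) : ℕ := nf.eval ![x]
def gn (n m : ℕ) : ℕ := if m < n then N m else 0
theorem ev_lt {n} (a : ElemFn n) (xs : Fin n → ℕ) : (ltF a).eval xs = T1 (a.eval xs) := rfl
theorem N_eq (x : ℕ) : N x = min (orN (1 - x) (gn x (eA x) * (gn x (eB x) * (gn x (eR x) *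
      (orN (1 - eR x) (orN (T1 (C (eA (eR x)) (eA x)))
        (eqN (eA (eR x)) (eA x) * orN (eqN (eB (eR x)) (eB x)) (tl (C (eB (eR x)) (eB x)))))))))) 1 := by
  have key : ∀ (z : ℕ), nf.eval ![z] = limRec _ _ _ (Fin.tail ![z]) z := fun z => rfl
  have hC : ∀ z (t : Fin 0 → ℕ), limRec _ _ _ t z = nf.eval ![z] := fun z t => by
    rw [key, Subsingleton.elim t]
  rw [N, key, limRec]
  simp only [hC]
  simp only [ev_or, ev_and, ev_not, ev_eq, ev_cmp, ev_thetaLt, ev_lt, ev_exp, ev_coeff, ev_tail]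
  rfl

theorem N_code (x : OT) : N x.code = tv (NF x) := by
  induction x with
  | zero => rw [N_eq]; simp [code, orN, tv, NF]
  | oadd a b r iha ihb ihr =>
    rw [N_eq, code_oadd]
    have ha := lt_a a.code b.code r.code
    have hb := lt_b a.code b.code r.code
    have hr := lt_r a.code b.code r.code
    have h0 : oc a.code b.code r.code ≠ 0 := by omega
    simp only [eA_oc, eB_oc, eR_oc, gn, if_pos ha, if_pos hb, if_pos hr, iha, ihb, ihr]
    cases r with
    | zero =>
      rw [not_tv, not_tv]
      have : ∀ m, orN (tv (zero.code = 0)) m = tv True := by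
        intro m; simp [tv, code, orN]
      rw [this]
      simp only [and_tv, or_tv, h0, NF, HeadLe]
      simp [Nat.min_eq_left (tv_le _)]
    | oadd a' b' r' =>
      have h0' : oc a'.code b'.code r'.code ≠ 0 := by have := lt_a a'.code b'.code r'.code; omega
      rw [code_oadd a' b' r']
      simp only [eA_oc, eB_oc, eR_oc, C_code, T1_t, tl_t, eq_tv, not_tv, or_tv, and_tv, code_eq, h0, h0']
      rw [code_oadd] at h0
      simp [h0, NF, HeadLe, Nat.min_eq_left (tv_le _)]

/-- `prec` denotes the order on the codes of terms in normal form. -/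
theorem prec_code (x y : OT) : prec.eval ![x.code, y.code] = 1 ↔ NF x ∧ NF y ∧ Lt x y := by
  have : prec.eval ![x.code, y.code] = (N x.code * N y.code) * T1 (C x.code y.code) := by
    have e : ∀ i : Fin 2, (app₁ nf (proj i)).eval ![x.code, y.code] = N (![x.code, y.code] i) := by
      intro i
      show nf.eval _ = nf.eval _; congr 1; funext i; fin_cases i; rfl
    rw [prec, ev_and, ev_and, ev_lt, ev_cmp, e, e]; rfl
  rw [this, N_code, N_code, C_code, T1_t, and_tv, and_tv, tv_one]
  tauto

/-- Every natural number is the code of a term. -/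
theorem code_surj (n : ℕ) : ∃ x : OT, x.code = n := by
  induction n using Nat.strong_induction_on with
  | _ n ih =>
    rcases Nat.eq_zero_or_pos n with rfl | h
    · exact ⟨zero, rfl⟩
    · obtain ⟨a, ha⟩ := ih (eA n) (by unfold eA; have := Nat.unpair_left_le (n-1); omega)
      obtain ⟨b, hb⟩ := ih (eB n) (by unfold eB; have := Nat.unpair_right_le (n-1); have := Nat.unpair_left_le (Nat.unpair (n-1)).2; omega)
      obtain ⟨r, hr⟩ := ih (eR n) (by unfold eR; have := Nat.unpair_right_le (n-1); have := Nat.unpair_right_le (Nat.unpair (n-1)).2; omega)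
      refine ⟨oadd a b r, ?_⟩
      rw [code_oadd, ha, hb, hr]; simp [oc, eA, eB, eR]; omega
end

end Encoding

/-! ### Bounded formulas, accessibility operators and the language -/

/-- The relation symbol `<` of the arithmetical language (`=` is logical). -/
inductive ArithRel : ℕ → Type
  | lt : ArithRel 2

/-- The language of arithmetic with a function constant for each elementary recursive function. -/
abbrev arith : Language := ⟨ElemFn, ArithRel⟩

/-- Bounded arithmetical formulas. Here `n` counts the bound variables in scope, `&n` is the newly
quantified one, and the bound `t` does not contain it. -/
inductive IsBounded {α : Type} : {n : ℕ} → arith.BoundedFormula α n → Prop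
  | falsum {n} : IsBounded (BoundedFormula.falsum : arith.BoundedFormula α n)
  | equal {n} (s t : arith.Term (α ⊕ Fin n)) : IsBounded (BoundedFormula.equal s t)
  | lt {n} (s t : arith.Term (α ⊕ Fin n)) :
      IsBounded (Relations.boundedFormula₂ (L := arith) ArithRel.lt s t)
  | imp {n} {φ ψ : arith.BoundedFormula α n} : IsBounded φ → IsBounded ψ → IsBounded (φ ⟹ ψ)
  | ball {n} (t : arith.Term (α ⊕ Fin n)) {φ : arith.BoundedFormula α (n + 1)} :
      IsBounded φ → IsBounded (∀' (Relations.boundedFormula₂ (L := arith) ArithRel.lt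
        (&(Fin.last n)) (t.relabel (Sum.map id Fin.castSucc)) ⟹ φ))
  | bex {n} (t : arith.Term (α ⊕ Fin n)) {φ : arith.BoundedFormula α (n + 1)} :
      IsBounded φ → IsBounded (∃' (Relations.boundedFormula₂ (L := arith) ArithRel.lt
        (&(Fin.last n)) (t.relabel (Sum.map id Fin.castSucc)) ⊓ φ))

/-- An accessibility operator `φ(X, x) ≡ ∀ y (θ(x, y) → t(x, y) ∈ X)` with a bounded arithmetical
formula `θ` and a term `t`. The variables `0` and `1` of `Fin 2` are `x` and `y`. -/
structure AccOp where
  θ : arith.Formula (Fin 2)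
  t : arith.Term (Fin 2)
  bounded : IsBounded θ

/-- The relation symbols of the language with a unary predicate constant `R_φ` for each
accessibility operator `φ`. -/
inductive IDRel : ℕ → Type
  | lt : IDRel 2
  | fix (φ : AccOp) : IDRel 1

/-- The language of arithmetic extended by the predicate constants `R_φ`. -/
abbrev LID : Language := ⟨ElemFn, IDRel⟩

/-- The inclusion of the arithmetical language. -/
def incl : arith →ᴸ LID where
  onFunction := fun _ f => f
  onRelation := fun _ r => match r with
    | .lt => IDRel.lt

/-- Terms and formulas with free variables named by natural numbers. -/
abbrev Tm := LID.Term ℕ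
abbrev Fm := LID.Formula ℕ

/-! ### First-order provability -/

/-- `∀ x φ` for a free variable `x` of `φ`. -/
def allVar {L : Language} (x : ℕ) (φ : L.Formula ℕ) : L.Formula ℕ :=
  ∀' (BoundedFormula.relabel (fun i => if i = x then Sum.inr (0 : Fin 1) else Sum.inl i) φ :
    L.BoundedFormula ℕ 1)

/-- `φ[t/x]`; it is capture-free since the free and the bound variables are kept apart. -/
def substVar {L : Language} (φ : L.Formula ℕ) (x : ℕ) (t : L.Term ℕ) : L.Formula ℕ :=
  BoundedFormula.subst φ (Function.update Term.var x t)

/-- Provability in first-order classical logic with equality from a set of axioms (a Hilbert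
calculus). Free variables of axioms are understood as universally quantified. -/
inductive Provable {L : Language} (Ax : Set (L.Formula ℕ)) : L.Formula ℕ → Prop
  | ax {φ} : φ ∈ Ax → Provable Ax φ
  | imp_const (φ ψ) : Provable Ax (φ ⟹ ψ ⟹ φ)
  | imp_dist (φ ψ χ) : Provable Ax ((φ ⟹ ψ ⟹ χ) ⟹ (φ ⟹ ψ) ⟹ φ ⟹ χ)
  | not_not (φ : L.Formula ℕ) : Provable Ax (∼(∼φ) ⟹ φ)
  | all_inst (x) (φ) (t) : Provable Ax (allVar x φ ⟹ substVar φ x t)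
  | all_imp (x) (φ ψ : L.Formula ℕ) : x ∉ BoundedFormula.freeVarFinset φ →
      Provable Ax (allVar x (φ ⟹ ψ) ⟹ φ ⟹ allVar x ψ)
  | eq_refl (t : L.Term ℕ) : Provable Ax (t.equal t)
  | eq_subst (x) (φ) (s t : L.Term ℕ) :
      Provable Ax (s.equal t ⟹ substVar φ x s ⟹ substVar φ x t)
  | mp {φ ψ} : Provable Ax (φ ⟹ ψ) → Provable Ax φ → Provable Ax ψ
  | gen (x) {φ} : Provable Ax φ → Provable Ax (allVar x φ)

/-! ### The axioms -/

/-- The variable `vᵢ`. -/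
def v (i : ℕ) : Tm := Term.var i

/-- `f(t₁, …, tₙ)` -/
def fn {n : ℕ} (f : ElemFn n) (ts : Fin n → Tm) : Tm := Term.func (L := LID) f ts

def zeroT : Tm := fn .zero ![]
def succT (s : Tm) : Tm := fn .succ ![s]
def addT (s t : Tm) : Tm := fn .add ![s, t]
def mulT (s t : Tm) : Tm := fn .mul ![s, t]
def monusT (s t : Tm) : Tm := fn .monus ![s, t]
def pairT (s t : Tm) : Tm := fn .pair ![s, t]

/-- `s < t` -/
def ltA (s t : Tm) : Fm := Relations.formula₂ (L := LID) IDRel.lt s t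

/-- `t ∈ R_φ` -/
def inR (φ : AccOp) (t : Tm) : Fm := Relations.formula₁ (L := LID) (IDRel.fix φ) t

/-- The variables `v₀, …, vₙ₋₁`. -/
def vars (n : ℕ) : Fin n → Tm := fun i => v i

/-- The defining axiom `f(z, x) = min H J` of `f = crec p h j`, where `H = h(z, x, v₁, …, vₖ)` and
`J = j(z, x)`. Here `min H J` is written as `H - (H - J)`, and the value `vᵢ` as
`(1 - ((pᵢ(z, x) + 1) - z)) * f(pᵢ(z, x), x)`. -/
def crecAx {n k : ℕ} (p : Fin k → ElemFn (n + 1)) (h : ElemFn (n + 1 + k))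
    (j : ElemFn (n + 1)) : Fm :=
  let f : ElemFn (n + 1) := .crec p h j
  let xs : Fin (n + 1) → Tm := vars (n + 1)
  let val : Fin k → Tm := fun i =>
    mulT (monusT (succT zeroT) (monusT (succT (fn (p i) xs)) (v 0)))
      (fn f (Fin.cons (fn (p i) xs) (Fin.tail xs) : Fin (n + 1) → Tm))
  let H : Tm := fn h (Fin.append xs val)
  let J : Tm := fn j xs
  (fn f xs).equal (monusT H (monusT H J))

/-- The axioms for `<` and the defining axioms for the function constants. -/
inductive DefAx : Fm → Prop
  | succ_ne_zero : DefAx (∼((succT (v 0)).equal zeroT))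
  | succ_inj : DefAx ((succT (v 0)).equal (succT (v 1)) ⟹ (v 0).equal (v 1))
  | not_lt_zero : DefAx (∼(ltA (v 0) zeroT))
  | lt_succ : DefAx (ltA (v 0) (succT (v 1)) ⇔ (ltA (v 0) (v 1) ⊔ (v 0).equal (v 1)))
  | add_zero : DefAx ((addT (v 0) zeroT).equal (v 0))
  | add_succ : DefAx ((addT (v 0) (succT (v 1))).equal (succT (addT (v 0) (v 1))))
  | mul_zero : DefAx ((mulT (v 0) zeroT).equal zeroT)
  | mul_succ : DefAx ((mulT (v 0) (succT (v 1))).equal (addT (mulT (v 0) (v 1)) (v 0)))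
  | monus_zero : DefAx ((monusT (v 0) zeroT).equal (v 0))
  | zero_monus : DefAx ((monusT zeroT (v 0)).equal zeroT)
  | succ_monus : DefAx ((monusT (succT (v 0)) (succT (v 1))).equal (monusT (v 0) (v 1)))
  | exp2_zero : DefAx ((fn .exp2 ![zeroT]).equal (succT zeroT))
  | exp2_succ : DefAx ((fn .exp2 ![succT (v 0)]).equal
      (addT (fn .exp2 ![v 0]) (fn .exp2 ![v 0])))
  | pair_lt : DefAx (ltA (v 0) (v 1) ⟹
      (pairT (v 0) (v 1)).equal (addT (mulT (v 1) (v 1)) (v 0)))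
  | pair_ge : DefAx (∼(ltA (v 0) (v 1)) ⟹
      (pairT (v 0) (v 1)).equal (addT (addT (mulT (v 0) (v 0)) (v 0)) (v 1)))
  | fst_snd : DefAx ((pairT (fn .fst ![v 0]) (fn .snd ![v 0])).equal (v 0))
  | proj {n} (i : Fin n) : DefAx ((fn (.proj i) (vars n)).equal (v i))
  | comp {m n} (f : ElemFn m) (g : Fin m → ElemFn n) :
      DefAx ((fn (.comp f g) (vars n)).equal (fn f (fun i => fn (g i) (vars n))))
  | crec {n k} (p : Fin k → ElemFn (n + 1)) (h : ElemFn (n + 1 + k)) (j : ElemFn (n + 1)) :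
      DefAx (crecAx p h j)

/-- Complete induction for `σ` with respect to its variable `x`:
`σ(0) ∧ ∀ x (σ(x) → σ(x + 1)) → ∀ x σ(x)`. -/
def indAx (σ : Fm) (x : ℕ) : Fm :=
  (substVar σ x zeroT ⊓ allVar x (σ ⟹ substVar σ x (succT (v x)))) ⟹ allVar x σ

/-- The axioms of elementary recursive arithmetic, in the language `LID`. -/
inductive EAAx : Fm → Prop
  | defAx {φ} : DefAx φ → EAAx φ
  | ind (θ : arith.Formula ℕ) (x : ℕ) : IsBounded θ → EAAx (indAx (incl.onFormula θ) x)

/-- The class of formulas `∀ y (θ → t ∈ R)` for a bounded arithmetical formula `θ`, a term `t` and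
one of the predicate constants `R`. All their free variables are parameters. -/
def IsAcc (σ : Fm) : Prop :=
  ∃ (y : ℕ) (θ : arith.Formula ℕ) (t : Tm) (φ : AccOp), IsBounded θ ∧
    σ = allVar y (incl.onFormula θ ⟹ inR φ t)

/-- `φ(σ, s) ≡ ∀ y (θ(s, y) → σ(t(s, y)))`, where `σ` is considered as a predicate of its variable
`x`. The variable `y` has to be fresh. -/
def AccOp.applyTo (φ : AccOp) (σ : Fm) (x y : ℕ) (s : Tm) : Fm :=
  allVar y (BoundedFormula.subst (incl.onFormula φ.θ) ![s, v y] ⟹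
    substVar σ x ((incl.onTerm φ.t).subst ![s, v y]))

/-- The axioms of the theory `Acc-ID(Acc)`. -/
inductive AccIDAx : Fm → Prop
  | ea {φ} : EAAx φ → AccIDAx φ
  /- complete induction for formulas in `Acc` -/
  | ind (σ : Fm) (x : ℕ) : IsAcc σ → AccIDAx (indAx σ x)
  /- `∀ x [φ(R_φ, x) → R_φ(x)]` -/
  | closed (φ : AccOp) : AccIDAx (allVar 0 (φ.applyTo (inR φ (v 0)) 0 1 (v 0) ⟹ inR φ (v 0)))
  /- `∀ u [R_φ(u) → ∀ x (φ(σ, x) → σ(x)) → σ(u)]` for `σ` in `Acc` -/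
  | least (φ : AccOp) (σ : Fm) (x y u : ℕ) : IsAcc σ → x ≠ y → x ≠ u →
      y ∉ BoundedFormula.freeVarFinset σ → u ∉ BoundedFormula.freeVarFinset σ →
      AccIDAx (allVar u (inR φ (v u) ⟹
        allVar x (φ.applyTo σ x y (v x) ⟹ σ) ⟹ substVar σ x (v u)))

/-- The theory `Acc-ID(Acc)`. -/
def AccID : Set Fm := {φ | AccIDAx φ}

/-! ### The accessible part of the order -/

/-- The bounded formula `y ≺ x`, with `x` and `y` the variables `0` and `1`. -/
def precFormula : arith.Formula (Fin 2) :=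
  BoundedFormula.equal
    (Term.func (L := arith) ElemFn.prec ![Term.var (Sum.inl 1), Term.var (Sum.inl 0)])
    (Term.func (L := arith) ElemFn.succ ![(Term.func (L := arith) ElemFn.zero ![])])

/-- The operator `∀ y (y ≺ x → y ∈ X)`. -/
def accPrec : AccOp := ⟨precFormula, Term.var 1, IsBounded.equal _ _⟩

/-- `s ≺ t`: both are codes of ordinal terms in normal form, and `s` is the smaller one. -/
def precA (s t : Tm) : Fm := (fn .prec ![s, t]).equal (succT zeroT)

/-- `t ∈ W`, where `W` is the accessible part of `≺`. -/
def inW (t : Tm) : Fm := inR accPrec t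

/-- The closed term for the code of an ordinal term. -/
def OT.quote : OT → Tm
  | .zero => zeroT
  | .oadd a b r => succT (pairT a.quote (pairT b.quote r.quote))

end WeakID

/-! Provability is replaced by truth in models. The language is countable, so a Henkin construction
yields completeness of the Hilbert calculus (`provable_of_forall_model`), and the argument then
takes place inside an arbitrary, possibly nonstandard, model of the theory. There `Prec` is the
interpretation of the order on codes and `W` that of its accessible part. Quantifier-free induction
gives enough arithmetic in the model to recover the recursion equations of the order (`Lt_oadd`,
`AllK_oadd`, `ExK_oadd`, `NF_oadd`). Neither linearity nor transitivity of the order is needed.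

The core is `W_th_omegaAdd`: if a countable `β` lies in `W`, then so does `ϑ(Ω·k + β)`. The case `β
= 0` gives `ϑ(Ω·k) ∈ W`, and `W` is closed downwards (`W_of_prec`). Three inductions are nested. The
outer one, on `k`, is metatheoretic: its claim quantifies over `β ∈ W`, so `W` occurs negatively in
it and it is not an `Acc` formula. The middle one runs along `W` on `β` (`W_induction`), and the
inner one runs over the codes of the predecessors `δ` of `ϑ(Ω·k + β)` (`W_code_induction`); for
fixed parameters both concern `Acc` formulas.

Let `δ = ϑ(b) + r` be such a predecessor. By `W_oadd` it suffices to have `ϑ(b)` and `r` in `W`. If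
`ϑ(b) < ϑ(Ω·k + β)` holds because `b < Ω·k + β` and `K(b)` lies below `ϑ(Ω·k + β)`, then `b = Ω·j +
β'` with `j < k`, or with `j = k` and `β' < β` (`eq_omegaAdd_of_Lt`). The summands of `β'` belong to
`K(b)`, so `β'` is a predecessor of `ϑ(Ω·k + β)` with a smaller code than `δ`; the inner hypothesis
puts it into `W`, and the outer or the middle hypothesis gives `ϑ(b) ∈ W`. If instead `ϑ(b)` is at
most an element of `K(Ω·k + β)`, then `b = 0` or `ϑ(b)` is at most a summand of `β`, and `β ∈ W`
suffices (`W_th_of_ExK`). The remainder `r` lies below `ϑ(b)`, or has the leading summand `ϑ(b)` and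
falls under the inner hypothesis. -/

namespace WeakID

/-! ### Completeness of the Hilbert calculus -/

/-! ### Instances of formulas with one bound variable left open. -/

section Instantiation

variable {L : FirstOrder.Language.{0, 0}}

/-- The substitution of `t` for the outermost bound variable, which is removed. -/
def instVar (t : L.Term ℕ) (k : ℕ) : ℕ ⊕ Fin (k + 1) → L.Term (ℕ ⊕ Fin k) :=
  Sum.elim (fun i => Term.var (Sum.inl i))
    (Fin.cons (t.relabel Sum.inl) (fun j => Term.var (Sum.inr j)))

/-- The instance of `φ` in which the outermost bound variable is replaced by `t`. -/
def inst (t : L.Term ℕ) : {k : ℕ} → L.BoundedFormula ℕ (k + 1) → L.BoundedFormula ℕ k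
  | _, .falsum => .falsum
  | k, .equal s u => .equal (s.subst (instVar t k)) (u.subst (instVar t k))
  | k, .rel R ts => .rel R (fun i => (ts i).subst (instVar t k))
  | _, .imp φ ψ => .imp (inst t φ) (inst t ψ)
  | _, .all φ => .all (inst t φ)

/-- The number of connectives and quantifiers. -/
def depth : {k : ℕ} → L.BoundedFormula ℕ k → ℕ
  | _, .falsum => 0
  | _, .equal _ _ => 0
  | _, .rel _ _ => 0
  | _, .imp φ ψ => depth φ + depth ψ + 1
  | _, .all φ => depth φ + 1

/-- An instance is not a subformula, so the truth lemma inducts on this measure instead of on the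
structure of formulas. -/
theorem depth_inst (t : L.Term ℕ) : ∀ {k : ℕ} (φ : L.BoundedFormula ℕ (k + 1)),
    depth (inst t φ) = depth φ
  | _, .falsum => by simp [inst, depth]
  | _, .equal _ _ => by simp [inst, depth]
  | _, .rel _ _ => by simp [inst, depth]
  | _, .imp φ ψ => by simp [inst, depth, depth_inst t φ, depth_inst t ψ]
  | _, .all φ => by simp [inst, depth, depth_inst t φ]

theorem realize_instVar {M : Type} [L.Structure M] (t : L.Term ℕ) {k : ℕ} (v : ℕ → M)
    (xs : Fin k → M) (s : L.Term (ℕ ⊕ Fin (k + 1))) :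
    (s.subst (instVar t k)).realize (Sum.elim v xs) =
      s.realize (Sum.elim v (Fin.cons (t.realize v) xs : Fin (k + 1) → M)) := by
  rw [Term.realize_subst]
  congr 1
  funext a
  rcases a with i | j
  · rfl
  · refine Fin.cases ?_ (fun j => ?_) j
    · simp [instVar, Term.realize_relabel, Function.comp_def]
    · simp [instVar]

theorem realize_inst {M : Type} [L.Structure M] (t : L.Term ℕ) (v : ℕ → M) :
    ∀ {k : ℕ} (φ : L.BoundedFormula ℕ (k + 1)) (xs : Fin k → M),
      (inst t φ).Realize v xs ↔ φ.Realize v (Fin.cons (t.realize v) xs : Fin (k + 1) → M)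
  | _, .falsum, _ => by simp only [inst]; rfl
  | _, .equal _ _, xs => by
    simp only [inst, BoundedFormula.Realize, realize_instVar]
  | _, .rel _ _, xs => by
    simp only [inst, BoundedFormula.Realize, realize_instVar]
  | _, .imp φ ψ, xs => by
    simp only [inst, BoundedFormula.Realize, realize_inst t v φ, realize_inst t v ψ]
  | _, .all φ, xs => by
    simp only [inst, BoundedFormula.Realize, realize_inst t v φ, Fin.cons_snoc_eq_snoc_cons]

/-- Binding a fresh `y` again puts it back at the outermost index `0`, where it came from. The only
difference is that indices are now counted by `1 + k` instead of `k + 1`. -/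
theorem relabel_subst_instVar (y : ℕ) {k : ℕ} (s : L.Term (ℕ ⊕ Fin (k + 1)))
    (hy : y ∉ s.varFinsetLeft) :
    (s.subst (instVar (Term.var y) k)).relabel
      (BoundedFormula.relabelAux
        (fun i => if i = y then Sum.inr (0 : Fin 1) else Sum.inl i) k) =
    s.relabel (Sum.map id (Fin.cast (Nat.add_comm k 1))) := by
  induction s with
  | var a =>
    rcases a with i | j
    · have : i ≠ y := fun h => hy (by simp [h])
      simp [instVar, Term.subst, BoundedFormula.relabelAux, this]
    · refine Fin.cases ?_ (fun j => ?_) j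
      · simp [instVar, Term.subst, BoundedFormula.relabelAux]
        rfl
      · simp [instVar, Term.subst, BoundedFormula.relabelAux]
        ext; simp [Nat.add_comm]
  | func f ts ih =>
    simp only [Term.subst, Term.relabel]
    congr 1
    funext i
    exact ih i (fun h => hy (by simp; exact ⟨i, h⟩))

theorem relabel_inst_term (y : ℕ) {k : ℕ} (s : L.Term (ℕ ⊕ Fin (k + 1)))
    (hy : y ∉ s.varFinsetLeft) :
    ((s.subst (instVar (Term.var y) k)).relabel
      (BoundedFormula.relabelAux
        (fun i => if i = y then Sum.inr (0 : Fin 1) else Sum.inl i) k)).relabel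
        (Sum.map id (Fin.castLE (Nat.add_comm 1 k).le)) = s := by
  rw [relabel_subst_instVar y s hy, Term.relabel_relabel]
  conv_rhs => rw [← Term.relabel_id s]
  congr 1
  funext a
  rcases a with i | j
  · rfl
  · rfl

theorem relabel_inst (y : ℕ) : ∀ {k : ℕ} (φ : L.BoundedFormula ℕ (k + 1)),
    y ∉ φ.freeVarFinset →
    (BoundedFormula.relabel (fun i => if i = y then Sum.inr (0 : Fin 1) else Sum.inl i)
      (inst (Term.var y) φ)).castLE (Nat.add_comm 1 k).le = φ
  | _, .falsum, _ => by simp only [inst]; rfl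
  | _, .equal s u, hy => by
    simp only [BoundedFormula.freeVarFinset, Finset.mem_union, not_or] at hy
    simp only [inst, BoundedFormula.relabel, BoundedFormula.mapTermRel, BoundedFormula.castLE]
    rw [relabel_inst_term y s hy.1, relabel_inst_term y u hy.2]
  | _, .rel R ts, hy => by
    simp only [BoundedFormula.freeVarFinset, Finset.mem_biUnion, not_exists, not_and] at hy
    simp only [inst, BoundedFormula.relabel, BoundedFormula.mapTermRel, BoundedFormula.castLE]
    congr 1
    funext i
    exact relabel_inst_term y (ts i) (hy i (Finset.mem_univ i))
  | _, .imp φ ψ, hy => by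
    simp only [BoundedFormula.freeVarFinset, Finset.mem_union, not_or] at hy
    simp only [inst, BoundedFormula.relabel_imp, BoundedFormula.castLE]
    rw [relabel_inst y φ hy.1, relabel_inst y ψ hy.2]
  | _, .all φ, hy => by
    simp only [inst, BoundedFormula.relabel_all, BoundedFormula.castLE]
    congr 1
    exact relabel_inst y φ hy

/-- The rules of the calculus speak of `allVar`, whereas an arbitrary universal formula is `∀' φ`. A
fresh name for the bound variable makes the quantifier rules applicable to the latter. -/
theorem allVar_inst (y : ℕ) (φ : L.BoundedFormula ℕ 1) (hy : y ∉ φ.freeVarFinset) :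
    allVar y (inst (Term.var y) φ) = ∀' φ := by
  have := relabel_inst y φ hy
  rw [BoundedFormula.castLE_rfl] at this
  rw [allVar]
  exact congrArg _ this

theorem subst_update_of_notMem (y : ℕ) (t : L.Term ℕ) (s : L.Term ℕ)
    (hy : y ∉ s.varFinset) : s.subst (Function.update Term.var y t) = s := by
  induction s with
  | var a =>
    have : a ≠ y := fun h => hy (by simp [h])
    simp [Term.subst, this]
  | func f ts ih =>
    simp only [Term.subst]
    congr 1
    funext i
    exact ih i (fun h => hy (by simp; exact ⟨i, h⟩))

theorem substVar_inst_term (y : ℕ) (t : L.Term ℕ) {k : ℕ} (s : L.Term (ℕ ⊕ Fin (k + 1)))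
    (hy : y ∉ s.varFinsetLeft) :
    (s.subst (instVar (Term.var y) k)).subst
      (Sum.elim (Term.relabel Sum.inl ∘ Function.update Term.var y t) (Term.var ∘ Sum.inr)) =
    s.subst (instVar t k) := by
  induction s with
  | var a =>
    rcases a with i | j
    · have : i ≠ y := fun h => hy (by simp [h])
      simp [instVar, Term.subst, this]
    · refine Fin.cases ?_ (fun j => ?_) j
      · simp [instVar, Term.subst]
      · simp [instVar, Term.subst]
  | func f ts ih =>
    simp only [Term.subst]
    congr 1
    funext i
    exact ih i (fun h => hy (by simp; exact ⟨i, h⟩))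

theorem substVar_inst (y : ℕ) (t : L.Term ℕ) : ∀ {k : ℕ} (φ : L.BoundedFormula ℕ (k + 1)),
    y ∉ φ.freeVarFinset →
    (inst (Term.var y) φ).subst (Function.update Term.var y t) = inst t φ
  | _, .falsum, _ => by simp only [inst]; rfl
  | _, .equal s u, hy => by
    simp only [BoundedFormula.freeVarFinset, Finset.mem_union, not_or] at hy
    simp only [inst, BoundedFormula.subst, BoundedFormula.mapTermRel]
    rw [substVar_inst_term y t s hy.1, substVar_inst_term y t u hy.2]
  | _, .rel R ts, hy => by
    simp only [BoundedFormula.freeVarFinset, Finset.mem_biUnion, not_exists, not_and] at hy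
    simp only [inst, BoundedFormula.subst, BoundedFormula.mapTermRel]
    congr 1
    funext i
    exact substVar_inst_term y t (ts i) (hy i (Finset.mem_univ i))
  | _, .imp φ ψ, hy => by
    simp only [BoundedFormula.freeVarFinset, Finset.mem_union, not_or] at hy
    have h₁ := substVar_inst y t φ hy.1
    have h₂ := substVar_inst y t ψ hy.2
    simp only [inst, BoundedFormula.subst, BoundedFormula.mapTermRel] at h₁ h₂ ⊢
    rw [h₁, h₂]
  | _, .all φ, hy => by
    have h₁ := substVar_inst y t φ hy
    simp only [inst, BoundedFormula.subst, BoundedFormula.mapTermRel, id] at h₁ ⊢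
    rw [h₁]

end Instantiation

/-! ### Semantics of `allVar` and `substVar`, and dependence on free variables only. -/

section Realization

variable {L : FirstOrder.Language.{0, 0}} {M : Type} [L.Structure M]

theorem realize_allVar (x : ℕ) (φ : L.Formula ℕ) (v : ℕ → M) :
    (allVar x φ).Realize v ↔ ∀ a : M, φ.Realize (Function.update v x a) := by
  unfold allVar Formula.Realize
  rw [BoundedFormula.realize_all]
  refine forall_congr' fun a => ?_
  rw [BoundedFormula.realize_relabel (n := 0) (m := 1)]
  have : (Sum.elim v ((Fin.snoc default a : Fin 1 → M) ∘ Fin.castAdd 0) ∘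
      fun i => if i = x then Sum.inr (0 : Fin 1) else Sum.inl i) = Function.update v x a := by
    funext i
    by_cases h : i = x
    · subst h; simp [Fin.snoc]
    · simp [h]
  rw [this]
  exact iff_of_eq (congrArg _ (Subsingleton.elim _ _))

theorem realize_substVar (x : ℕ) (φ : L.Formula ℕ) (t : L.Term ℕ) (v : ℕ → M) :
    (substVar φ x t).Realize v ↔ φ.Realize (Function.update v x (t.realize v)) := by
  unfold substVar Formula.Realize
  rw [BoundedFormula.realize_subst]
  have : (fun a => (Function.update Term.var x t a : L.Term ℕ).realize v) =
      Function.update v x (t.realize v) := by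
    funext i
    by_cases h : i = x
    · subst h; simp
    · simp [h]
  rw [this]

theorem realize_term_congr {α : Type} [DecidableEq α] {n : ℕ} {v w : α → M} {xs : Fin n → M}
    (s : L.Term (α ⊕ Fin n))
    (h : ∀ i ∈ s.varFinsetLeft, v i = w i) :
    s.realize (Sum.elim v xs) = s.realize (Sum.elim w xs) := by
  induction s with
  | var a => rcases a with i | j
             · simpa using h i (by simp)
             · rfl
  | func f ts ih =>
    simp only [Term.realize]
    congr 1
    funext i
    exact ih i fun j hj => h j (by simp; exact ⟨i, hj⟩)

theorem realize_congr {α : Type} [DecidableEq α] {v w : α → M} :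
    ∀ {n : ℕ} (φ : L.BoundedFormula α n) (xs : Fin n → M),
    (∀ i ∈ φ.freeVarFinset, v i = w i) → (φ.Realize v xs ↔ φ.Realize w xs)
  | _, .falsum, _, _ => Iff.rfl
  | _, .equal s u, xs, h => by
    simp only [BoundedFormula.freeVarFinset, Finset.mem_union] at h
    simp only [BoundedFormula.Realize]
    rw [realize_term_congr s fun i hi => h i (.inl hi),
      realize_term_congr u fun i hi => h i (.inr hi)]
  | _, .rel R ts, xs, h => by
    simp only [BoundedFormula.freeVarFinset, Finset.mem_biUnion] at h
    simp only [BoundedFormula.Realize]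
    have : ∀ i, (ts i).realize (Sum.elim v xs) = (ts i).realize (Sum.elim w xs) := fun i =>
      realize_term_congr (ts i) fun j hj => h j ⟨i, Finset.mem_univ i, hj⟩
    simp only [this]
  | _, .imp φ ψ, xs, h => by
    simp only [BoundedFormula.freeVarFinset, Finset.mem_union] at h
    simp only [BoundedFormula.Realize]
    rw [realize_congr φ xs fun i hi => h i (.inl hi),
      realize_congr ψ xs fun i hi => h i (.inr hi)]
  | _, .all φ, xs, h => by
    simp only [BoundedFormula.Realize]
    exact forall_congr' fun a => realize_congr φ _ h

end Realization

/-! ### Derivations from finite lists of assumptions, and Henkin sets. -/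

section Calculus

variable {L : FirstOrder.Language.{0, 0}} {Ax : Set (L.Formula ℕ)}

/-- `γ₁ → ⋯ → γₙ → φ` -/
def chain (Γ : List (L.Formula ℕ)) (φ : L.Formula ℕ) : L.Formula ℕ :=
  Γ.foldr (fun γ ψ => γ ⟹ ψ) φ

theorem Provable.const (φ : L.Formula ℕ) {ψ : L.Formula ℕ} (h : Provable Ax ψ) :
    Provable Ax (φ ⟹ ψ) :=
  .mp (.imp_const ψ φ) h

theorem Provable.trans {φ ψ χ : L.Formula ℕ} (h₁ : Provable Ax (φ ⟹ ψ))
    (h₂ : Provable Ax (ψ ⟹ χ)) : Provable Ax (φ ⟹ χ) :=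
  .mp (.mp (.imp_dist φ ψ χ) (.const φ h₂)) h₁

theorem Provable.refl (φ : L.Formula ℕ) : Provable Ax (φ ⟹ φ) :=
  .mp (.mp (.imp_dist φ (φ ⟹ φ) φ) (.imp_const φ (φ ⟹ φ))) (.imp_const φ φ)

theorem chain_append (Γ Δ : List (L.Formula ℕ)) (φ : L.Formula ℕ) :
    chain (Γ ++ Δ) φ = chain Γ (chain Δ φ) := by
  simp [chain]

theorem Provable.chain {φ : L.Formula ℕ} (h : Provable Ax φ) :
    ∀ Γ : List (L.Formula ℕ), Provable Ax (chain Γ φ)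
  | [] => h
  | γ :: Γ => .const γ (h.chain Γ)

theorem Provable.chain_dist (φ ψ : L.Formula ℕ) : ∀ Γ : List (L.Formula ℕ),
    Provable Ax (WeakID.chain Γ (φ ⟹ ψ) ⟹ WeakID.chain Γ φ ⟹ WeakID.chain Γ ψ)
  | [] => .refl _
  | γ :: Γ =>
    .trans (.mp (.imp_dist _ _ _) (.const γ (Provable.chain_dist φ ψ Γ))) (.imp_dist _ _ _)

theorem Provable.chain_mp {φ ψ : L.Formula ℕ} {Γ : List (L.Formula ℕ)}
    (h₁ : Provable Ax (WeakID.chain Γ (φ ⟹ ψ))) (h₂ : Provable Ax (WeakID.chain Γ φ)) :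
    Provable Ax (WeakID.chain Γ ψ) :=
  .mp (.mp (.chain_dist φ ψ Γ) h₁) h₂

theorem Provable.chain_weaken {φ : L.Formula ℕ} {Γ : List (L.Formula ℕ)}
    (h : Provable Ax (WeakID.chain Γ φ)) (Δ : List (L.Formula ℕ)) :
    Provable Ax (WeakID.chain (Γ ++ Δ) φ) := by
  rw [chain_append]
  refine .chain_mp (.chain ?_ Γ) h
  induction Δ with
  | nil => exact .refl _
  | cons δ Δ ih => exact .trans ih (.imp_const _ _)

theorem Provable.chain_last (Γ : List (L.Formula ℕ)) (φ : L.Formula ℕ) :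
    Provable Ax (WeakID.chain (Γ ++ [φ]) φ) := by
  rw [chain_append]
  exact .chain (.refl φ) Γ

/-- Together with `gen`, this is generalization under assumptions. The variable must be new to `Γ`
only, since the axioms count as universally closed. -/
theorem Provable.chain_all (x : ℕ) (φ : L.Formula ℕ) : ∀ Γ : List (L.Formula ℕ),
    (∀ γ ∈ Γ, x ∉ BoundedFormula.freeVarFinset γ) →
    Provable Ax (allVar x (WeakID.chain Γ φ) ⟹ WeakID.chain Γ (allVar x φ))
  | [], _ => .refl _
  | γ :: Γ, h => by
    refine .trans (.all_imp x γ _ (h γ (by simp))) ?_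
    exact .mp (.imp_dist _ _ _)
      (.const γ (Provable.chain_all x φ Γ fun δ hδ => h δ (by simp [hδ])))

theorem Provable.of_chain_not {φ : L.Formula ℕ} {Γ : List (L.Formula ℕ)}
    (h : Provable Ax (WeakID.chain (Γ ++ [∼φ]) φ)) : Provable Ax (WeakID.chain Γ φ) := by
  have h₁ : Provable Ax (WeakID.chain (Γ ++ [∼φ]) ⊥) := .chain_mp (.chain_last Γ (∼φ)) h
  rw [chain_append] at h₁
  exact .chain_mp (.chain (.not_not φ) Γ) h₁

/-- A variable that is free neither in `φ` nor in `Γ`. -/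
theorem exists_fresh (Γ : List (L.Formula ℕ)) {n : ℕ} (φ : L.BoundedFormula ℕ n) :
    ∃ y : ℕ, (∀ γ ∈ Γ, y ∉ BoundedFormula.freeVarFinset γ) ∧ y ∉ φ.freeVarFinset := by
  classical
  obtain ⟨y, hy⟩ := Infinite.exists_notMem_finset
    (Γ.toFinset.biUnion (fun γ => BoundedFormula.freeVarFinset γ) ∪ φ.freeVarFinset)
  simp only [Finset.mem_union, Finset.mem_biUnion, List.mem_toFinset, not_or, not_exists,
    not_and] at hy
  exact ⟨y, hy.1, hy.2⟩

/-- `Γ` is consistent with the axioms. -/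
def Consistent (Ax : Set (L.Formula ℕ)) (Γ : List (L.Formula ℕ)) : Prop :=
  ¬ Provable Ax (chain Γ ⊥)

theorem Consistent.append_not {φ : L.Formula ℕ} {Γ : List (L.Formula ℕ)}
    (h : ¬ Provable Ax (chain Γ φ)) : Consistent Ax (Γ ++ [∼φ]) := by
  intro h₁
  rw [chain_append] at h₁
  exact h (.chain_mp (.chain (.not_not φ) Γ) h₁)

/-- Every consistent `Γ` extends to one that decides `φ`, with a counterexample if `φ` is a
universal formula that is refuted. -/
theorem Consistent.exists_extend {Γ : List (L.Formula ℕ)} (hΓ : Consistent Ax Γ)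
    (φ : L.Formula ℕ) : ∃ Δ, Consistent Ax (Γ ++ Δ) ∧
      (Provable Ax (chain (Γ ++ Δ) φ) ∨ (Provable Ax (chain (Γ ++ Δ) (∼φ)) ∧
        ∀ χ : L.BoundedFormula ℕ 1, φ = ∀' χ →
          ∃ y : ℕ, Provable Ax (chain (Γ ++ Δ) (∼(inst (Term.var y) χ : L.Formula ℕ))))) := by
  by_cases h : Provable Ax (chain Γ φ)
  · exact ⟨[], by simpa using hΓ, .inl (by simpa using h)⟩
  · by_cases hφ : ∃ χ : L.BoundedFormula ℕ 1, φ = ∀' χ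
    · obtain ⟨χ, rfl⟩ := hφ
      -- The free variable `y` serves as Henkin constant; one is always available because the
      -- assumptions are finitely many. If its negated instance were inconsistent with them,
      -- generalization over `y` would derive `∀' χ` from its own negation, hence from `Γ`.
      obtain ⟨y, hy, hyχ⟩ := exists_fresh (Γ ++ [∼(∀' χ : L.Formula ℕ)]) χ
      refine ⟨[∼(∀' χ), ∼(inst (Term.var y) χ : L.Formula ℕ)], ?_, .inr ⟨?_, ?_⟩⟩
      · have : Consistent Ax ((Γ ++ [∼(∀' χ)]) ++ [∼(inst (Term.var y) χ : L.Formula ℕ)]) := by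
          refine Consistent.append_not fun h₁ => h (.of_chain_not ?_)
          have h₂ := Provable.mp (.chain_all y _ _ hy) (.gen y h₁)
          rwa [allVar_inst y χ hyχ] at h₂
        simpa using this
      · have := (Provable.chain_last (Ax := Ax) Γ (∼(∀' χ))).chain_weaken
          [∼(inst (Term.var y) χ : L.Formula ℕ)]
        simpa using this
      · intro χ' h'
        obtain rfl : χ = χ' := by injection h'
        have := Provable.chain_last (Ax := Ax) (Γ ++ [∼(∀' χ)])
          (∼(inst (Term.var y) χ : L.Formula ℕ))
        exact ⟨y, by simpa using this⟩
    · exact ⟨[∼φ], .append_not h, .inr ⟨.chain_last _ _, fun χ h' => (hφ ⟨χ, h'⟩).elim⟩⟩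

/-- A complete consistent set of formulas that contains the axioms, and a counterexample to each
universal formula that it does not contain. -/
structure Henkin (Ax : Set (L.Formula ℕ)) (S : Set (L.Formula ℕ)) : Prop where
  thm {φ} : Provable Ax φ → φ ∈ S
  mp {φ ψ : L.Formula ℕ} : (φ ⟹ ψ) ∈ S → φ ∈ S → ψ ∈ S
  bot : (⊥ : L.Formula ℕ) ∉ S
  not {φ} : φ ∉ S → (∼φ) ∈ S
  witness {χ : L.BoundedFormula ℕ 1} : (∀' χ) ∉ S →
    ∃ y : ℕ, (inst (Term.var y) χ : L.Formula ℕ) ∉ S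

/-- All formulas are enumerated and decided one after another, so each stage is a finite list of
assumptions. The set consists of everything derivable at some stage. -/
theorem exists_henkin [Countable (L.Formula ℕ)] {Γ : List (L.Formula ℕ)}
    (hΓ : Consistent Ax Γ) : ∃ S, Henkin Ax S ∧ ∀ φ, Provable Ax (chain Γ φ) → φ ∈ S := by
  obtain ⟨e, he⟩ := exists_surjective_nat (L.Formula ℕ)
  choose ext hcons hext using fun (Γ : {Γ // Consistent Ax Γ}) φ => Γ.2.exists_extend φ
  let G : ℕ → {Γ // Consistent Ax Γ} := fun n =>
    Nat.rec ⟨Γ, hΓ⟩ (fun n Γ => ⟨Γ.1 ++ ext Γ (e n), hcons Γ (e n)⟩) n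
  have hG : ∀ n, (G (n + 1)).1 = (G n).1 ++ ext (G n) (e n) := fun n => rfl
  have mono : ∀ m n φ, m ≤ n → Provable Ax (chain (G m).1 φ) → Provable Ax (chain (G n).1 φ) := by
    intro m n φ hmn h
    induction n, hmn using Nat.le_induction with
    | base => exact h
    | succ n _ ih => rw [hG]; exact ih.chain_weaken _
  let S : Set (L.Formula ℕ) := {φ | ∃ n, Provable Ax (chain (G n).1 φ)}
  have hmp : ∀ {φ ψ : L.Formula ℕ}, (φ ⟹ ψ) ∈ S → φ ∈ S → ψ ∈ S := by
    rintro φ ψ ⟨m, hm⟩ ⟨n, hn⟩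
    exact ⟨max m n, .chain_mp (mono m _ _ (le_max_left _ _) hm) (mono n _ _ (le_max_right _ _) hn)⟩
  have hbot : (⊥ : L.Formula ℕ) ∉ S := fun ⟨n, hn⟩ => (G n).2 hn
  have hdec : ∀ φ, φ ∈ S ∨ ((∼φ) ∈ S ∧ ∀ χ : L.BoundedFormula ℕ 1, φ = ∀' χ →
      ∃ y : ℕ, (∼(inst (Term.var y) χ : L.Formula ℕ)) ∈ S) := by
    intro φ
    obtain ⟨n, rfl⟩ := he φ
    rcases hext (G n) (e n) with h | ⟨h, h'⟩
    · exact .inl ⟨n + 1, h⟩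
    · refine .inr ⟨⟨n + 1, h⟩, fun χ hχ => ?_⟩
      obtain ⟨y, hy⟩ := h' χ hχ
      exact ⟨y, n + 1, hy⟩
  refine ⟨S, ⟨fun h => ⟨0, h.chain _⟩, hmp, hbot, fun {φ} h => ?_, fun {χ} h => ?_⟩,
    fun φ h => ⟨0, h⟩⟩
  · exact ((hdec φ).resolve_left h).1
  · obtain ⟨y, hy⟩ := ((hdec _).resolve_left h).2 χ rfl
    exact ⟨y, fun h' => hbot (hmp hy h')⟩

end Calculus

/-! ### The term model of a Henkin set. -/

namespace Henkin

variable {L : FirstOrder.Language.{0, 0}} {Ax S : Set (L.Formula ℕ)}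

theorem imp_iff (hS : Henkin Ax S) {φ ψ : L.Formula ℕ} : (φ ⟹ ψ) ∈ S ↔ (φ ∈ S → ψ ∈ S) := by
  refine ⟨fun h h' => hS.mp h h', fun h => ?_⟩
  by_cases hφ : φ ∈ S
  · exact hS.mp (hS.thm (.imp_const ψ φ)) (h hφ)
  · have h₁ : (⊥ ⟹ ψ) ∈ S :=
      hS.thm (.trans (.imp_const ⊥ (∼ψ)) (.not_not ψ))
    have h₂ : (φ ⟹ ⊥ ⟹ ψ) ∈ S := hS.mp (hS.thm (.imp_const _ φ)) h₁
    exact hS.mp (hS.mp (hS.thm (.imp_dist φ ⊥ ψ)) h₂) (hS.not hφ)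

theorem all_iff (hS : Henkin Ax S) {χ : L.BoundedFormula ℕ 1} :
    (∀' χ) ∈ S ↔ ∀ t : L.Term ℕ, (inst t χ : L.Formula ℕ) ∈ S := by
  constructor
  · intro h t
    obtain ⟨y, -, hy⟩ := exists_fresh [] χ
    have := hS.thm (.all_inst (Ax := Ax) y (inst (Term.var y) χ) t)
    rw [allVar_inst y χ hy] at this
    have h' := hS.mp this h
    rwa [substVar, substVar_inst y t χ hy] at h'
  · intro h
    by_contra hn
    obtain ⟨y, hy⟩ := hS.witness hn
    exact hy (h _)

/-- Equality of terms according to `S`. -/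
def Eqv (S : Set (L.Formula ℕ)) (s t : L.Term ℕ) : Prop := s.equal t ∈ S

/-- The equality axiom replaces a single term, so the arguments are exchanged one at a time. At each
position a fresh variable `x` marks the place to be substituted; `A` collects the variables that `C`
itself may contain. -/
theorem congr (hS : Henkin Ax S) {n : ℕ} (C : (Fin n → L.Term ℕ) → L.Formula ℕ) (A : Finset ℕ)
    (hC : ∀ x ∉ A, ∀ w u, substVar (C w) x u =
      C (fun i => (w i).subst (Function.update Term.var x u)))
    {s t : Fin n → L.Term ℕ} (hst : ∀ i, Eqv S (s i) (t i)) (h : C s ∈ S) : C t ∈ S := by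
  obtain ⟨x, hx⟩ := Infinite.exists_notMem_finset
    (A ∪ (Finset.univ.biUnion fun i => (s i).varFinset ∪ (t i).varFinset))
  simp only [Finset.mem_union, Finset.mem_biUnion, Finset.mem_univ, true_and, not_or,
    not_exists] at hx
  obtain ⟨hxA, hx⟩ := hx
  have step : ∀ k ≤ n, C (fun i => if (i : ℕ) < k then t i else s i) ∈ S := by
    intro k hk
    induction k with
    | zero => simpa using h
    | succ k ih =>
      let w : Fin n → L.Term ℕ := fun i =>
        if (i : ℕ) < k then t i else if (i : ℕ) = k then Term.var x else s i
      have hw : ∀ u, substVar (C w) x u =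
          C (fun i => if (i : ℕ) < k then t i else if (i : ℕ) = k then u else s i) := by
        intro u
        rw [hC x hxA]
        congr 1
        funext i
        by_cases h₁ : (i : ℕ) < k
        · simp [w, h₁, subst_update_of_notMem x u (t i) (hx i).2]
        · by_cases h₂ : (i : ℕ) = k
          · simp [w, h₂, Term.subst]
          · simp [w, h₁, h₂, subst_update_of_notMem x u (s i) (hx i).1]
      have := hS.thm (.eq_subst (Ax := Ax) x (C w) (s ⟨k, hk⟩) (t ⟨k, hk⟩))
      rw [hw, hw] at this
      have h₁ := hS.mp (hS.mp this (hst _)) (by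
        convert ih (Nat.le_of_succ_le hk) using 3 with i
        by_cases h₂ : (i : ℕ) = k
        · subst h₂; simp
        · simp [h₂])
      convert h₁ using 3 with i
      rcases lt_trichotomy (i : ℕ) k with h₂ | h₂ | h₂
      · simp [h₂, Nat.lt_succ_of_lt h₂]
      · subst h₂; simp
      · simp [h₂.ne', not_lt_of_gt h₂, show ¬ (i : ℕ) < k + 1 by omega]
  have := step n le_rfl
  simpa using this

theorem subst_equal (x : ℕ) (u s t : L.Term ℕ) : substVar (s.equal t) x u =
    (s.subst (Function.update Term.var x u)).equal (t.subst (Function.update Term.var x u)) := by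
  have key : ∀ s : L.Term ℕ, (s.relabel Sum.inl : L.Term (ℕ ⊕ Fin 0)).subst
      (Sum.elim (Term.relabel Sum.inl ∘ Function.update Term.var x u) (Term.var ∘ Sum.inr)) =
      (s.subst (Function.update Term.var x u)).relabel Sum.inl := by
    intro s
    induction s with
    | var => rfl
    | func f ts ih => simp [Term.subst, Term.relabel, ih]
  simp only [substVar, Term.equal, Term.bdEqual, BoundedFormula.subst, BoundedFormula.mapTermRel,
    key]

theorem subst_rel (x : ℕ) (u : L.Term ℕ) {n : ℕ} (R : L.Relations n) (ts : Fin n → L.Term ℕ) :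
    substVar (R.formula ts) x u =
      R.formula (fun i => (ts i).subst (Function.update Term.var x u)) := by
  have key : ∀ s : L.Term ℕ, (s.relabel Sum.inl : L.Term (ℕ ⊕ Fin 0)).subst
      (Sum.elim (Term.relabel Sum.inl ∘ Function.update Term.var x u) (Term.var ∘ Sum.inr)) =
      (s.subst (Function.update Term.var x u)).relabel Sum.inl := by
    intro s
    induction s with
    | var => rfl
    | func f ts ih => simp [Term.subst, Term.relabel, ih]
  simp only [substVar, Relations.formula, Relations.boundedFormula, BoundedFormula.subst,
    BoundedFormula.mapTermRel, key, id]

theorem eqv_refl (hS : Henkin Ax S) (s : L.Term ℕ) : Eqv S s s := hS.thm (.eq_refl s)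

/-- Congruence for the equality formula itself, from which symmetry and transitivity both follow. -/
theorem eqv_congr (hS : Henkin Ax S) {s s' t t' : L.Term ℕ} (hs : Eqv S s s') (ht : Eqv S t t')
    (h : Eqv S s t) : Eqv S s' t' := by
  have := hS.congr (n := 2) (fun w => (w 0).equal (w 1)) ∅
    (fun x _ w u => subst_equal x u _ _) (s := ![s, t]) (t := ![s', t'])
    (by intro i; fin_cases i; exacts [hs, ht]) h
  exact this

theorem eqv_symm (hS : Henkin Ax S) {s t : L.Term ℕ} (h : Eqv S s t) : Eqv S t s :=
  hS.eqv_congr h (hS.eqv_refl s) (hS.eqv_refl s)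

theorem eqv_trans (hS : Henkin Ax S) {s t u : L.Term ℕ} (h : Eqv S s t) (h' : Eqv S t u) :
    Eqv S s u :=
  hS.eqv_congr (hS.eqv_refl s) h' h

/-- The terms up to equality according to `S`. -/
def setoid (hS : Henkin Ax S) : Setoid (L.Term ℕ) :=
  ⟨Eqv S, hS.eqv_refl, hS.eqv_symm, hS.eqv_trans⟩

/-- The term structure. -/
@[reducible] def prestructure (hS : Henkin Ax S) : L.Prestructure hS.setoid where
  toStructure := ⟨fun f ts => Term.func f ts, fun R ts => R.formula ts ∈ S⟩
  fun_equiv := by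
    intro n f x y hxy
    refine hS.congr (fun w => (Term.func f x).equal (Term.func f w)) (Term.func f x).varFinset
      (fun z hz w u => ?_) hxy (hS.eqv_refl _)
    rw [subst_equal, subst_update_of_notMem z u _ hz]
    rfl
  rel_equiv := by
    intro n R x y hxy
    have : ∀ {x y : Fin n → L.Term ℕ}, (∀ i, Eqv S (x i) (y i)) → R.formula x ∈ S →
        R.formula y ∈ S := fun hxy h =>
      hS.congr (fun w => R.formula w) ∅ (fun z _ w u => subst_rel z u R w) hxy h
    exact propext ⟨this hxy, this fun i => hS.eqv_symm (hxy i)⟩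

/-- The universe of the term model. -/
def Model (hS : Henkin Ax S) : Type := Quotient hS.setoid

instance (hS : Henkin Ax S) : L.Structure hS.Model :=
  letI := hS.prestructure
  inferInstanceAs (L.Structure (Quotient hS.setoid))

/-- The canonical assignment. -/
def assign (hS : Henkin Ax S) (i : ℕ) : hS.Model := Quotient.mk hS.setoid (Term.var i)

/-- Before passing to the quotient, a term evaluated in the term structure with each variable
denoting itself is that very term. -/
theorem realize_term (hS : Henkin Ax S) (t : L.Term ℕ) :
    t.realize hS.assign = Quotient.mk hS.setoid t := by
  let := hS.prestructure
  have h := Term.realize_quotient_mk' hS.setoid t (fun i => (Term.var i : L.Term ℕ))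
  refine h.trans (congrArg _ ?_)
  clear h
  induction t with
  | var => rfl
  | func f ts ih =>
    simp only [Term.realize, ih]
    rfl

/-- The truth lemma. In the universal case the elements of the model are exactly the classes of
terms, so truth reduces to truth of all instances, which have smaller depth. -/
theorem realize_iff_mem (hS : Henkin Ax S) : ∀ (n : ℕ) (φ : L.Formula ℕ), depth φ ≤ n →
    (φ.Realize hS.assign ↔ φ ∈ S) := by
  have hterm : ∀ t : L.Term (ℕ ⊕ Fin 0), ∃ s : L.Term ℕ, t = s.relabel Sum.inl := by
    intro t
    refine ⟨t.relabel (Sum.elim id finZeroElim), ?_⟩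
    rw [Term.relabel_relabel]
    conv_lhs => rw [← Term.relabel_id t]
    congr 1
    funext a
    rcases a with i | j
    · rfl
    · exact j.elim0
  intro n
  induction n with
  | zero =>
    intro φ hφ
    cases φ with
    | falsum => exact ⟨fun h => h.elim, fun h => (hS.bot h).elim⟩
    | equal s t =>
      obtain ⟨s, rfl⟩ := hterm s
      obtain ⟨t, rfl⟩ := hterm t
      change (s.equal t).Realize hS.assign ↔ Eqv S s t
      rw [Formula.realize_equal, realize_term, realize_term]
      exact Quotient.eq (r := hS.setoid)
    | rel R ts =>
      choose us hus using fun i => hterm (ts i)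
      obtain rfl : ts = fun i => (us i).relabel Sum.inl := funext hus
      change (R.formula us).Realize hS.assign ↔ R.formula us ∈ S
      rw [Formula.realize_rel]
      simp only [realize_term]
      let := hS.prestructure
      exact relMap_quotient_mk' hS.setoid R us
    | imp => simp [depth] at hφ
    | all => simp [depth] at hφ
  | succ n ih =>
    intro φ hφ
    by_cases h0 : depth φ ≤ n
    · exact ih φ h0
    cases φ with
    | falsum => simp [depth] at h0
    | equal => simp [depth] at h0
    | rel => simp [depth] at h0
    | imp φ ψ =>
      simp only [depth] at hφ
      rw [hS.imp_iff, ← ih φ (by omega), ← ih ψ (by omega)]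
      rfl
    | all χ =>
      simp only [depth] at hφ
      rw [hS.all_iff]
      have h₁ : ∀ t : L.Term ℕ, (inst t χ : L.Formula ℕ) ∈ S ↔
          χ.Realize hS.assign (Fin.snoc default (Quotient.mk hS.setoid t) : Fin 1 → hS.Model) := by
        intro t
        rw [← ih (inst t χ) (by rw [depth_inst]; omega), Formula.Realize, realize_inst,
          realize_term]
        refine iff_of_eq (congrArg _ ?_)
        funext i
        obtain rfl : i = 0 := Fin.fin_one_eq_zero i
        rfl
      simp only [h₁]
      exact ⟨fun h t => h _, fun h a => Quotient.inductionOn a h⟩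

/-- The term model satisfies the axioms under all assignments. -/
theorem realize_of_provable (hS : Henkin Ax S) {φ : L.Formula ℕ} (h : Provable Ax φ)
    (v : ℕ → hS.Model) : φ.Realize v := by
  -- The truth lemma covers only the canonical assignment. Generalization allows its values to be
  -- changed at one variable after another, and the finitely many free variables of a formula
  -- suffice.
  have key : ∀ l : List ℕ, ∀ ψ : L.Formula ℕ, Provable Ax ψ →
      ψ.Realize (fun i => if i ∈ l then v i else hS.assign i) := by
    intro l
    induction l with
    | nil =>
      intro ψ hψ
      simpa using (hS.realize_iff_mem _ ψ le_rfl).2 (hS.thm hψ)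
    | cons x l ih =>
      intro ψ hψ
      have h₁ := (realize_allVar x ψ _).1 (ih _ (.gen x hψ)) (v x)
      convert h₁ using 1
      funext i
      by_cases hi : i = x
      · subst hi; simp
      · simp [hi]
  refine (realize_congr φ _ fun i hi => ?_).1 (key (BoundedFormula.freeVarFinset φ).toList φ h)
  simp [hi]

end Henkin

/-- The completeness theorem. -/
theorem provable_of_forall_model {L : FirstOrder.Language.{0, 0}} [Countable (L.Formula ℕ)]
    {Ax : Set (L.Formula ℕ)} {φ : L.Formula ℕ}
    (h : ∀ (M : Type) [L.Structure M], (∀ ψ ∈ Ax, ∀ v : ℕ → M, ψ.Realize v) →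
      ∀ v : ℕ → M, φ.Realize v) : Provable Ax φ := by
  by_contra hφ
  obtain ⟨S, hS, hΓ⟩ := exists_henkin (Consistent.append_not (Γ := []) hφ)
  have h₁ := h hS.Model (fun ψ hψ v => hS.realize_of_provable (.ax hψ) v) hS.assign
  have h₂ := (hS.realize_iff_mem _ φ le_rfl).1 h₁
  exact hS.bot (hS.mp (hΓ _ (.chain_last [] (∼φ))) h₂)

/-! ### Countability of the language -/

namespace ElemFn

/-- A code of a definition of an elementary recursive function of given arity. -/
def index : {n : ℕ} → ElemFn n → ℕ
  | _, .zero => Nat.pair 0 0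
  | _, .succ => Nat.pair 1 0
  | _, .add => Nat.pair 2 0
  | _, .mul => Nat.pair 3 0
  | _, .monus => Nat.pair 4 0
  | _, .exp2 => Nat.pair 5 0
  | _, .pair => Nat.pair 6 0
  | _, .fst => Nat.pair 7 0
  | _, .snd => Nat.pair 8 0
  | _, .proj i => Nat.pair 9 i
  | _, .comp (m := m) f g =>
    Nat.pair 10 (Nat.pair m (Nat.pair f.index (Encodable.encode fun i => (g i).index)))
  | _, .crec (k := k) p h j =>
    Nat.pair 11 (Nat.pair k (Nat.pair (Encodable.encode fun i => (p i).index)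
      (Nat.pair h.index j.index)))

theorem index_injective : ∀ {n : ℕ} (f g : ElemFn n), f.index = g.index → f = g := by
  intro n f
  induction f with
  | proj i =>
    intro g h
    cases g <;> simp [index, Nat.pair_eq_pair, Fin.val_inj] at h ⊢
    exact h
  | comp f g ihf ihg =>
    intro e h
    cases e with
    | comp f' g' =>
      simp only [index, Nat.pair_eq_pair, true_and] at h
      obtain ⟨rfl, h₁, h₂⟩ := h
      have h₃ := congrFun (Encodable.encode_injective h₂)
      rw [ihf _ h₁, funext fun i => ihg i _ (h₃ i)]
    | _ => simp [index, Nat.pair_eq_pair] at h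
  | crec p h j ihp ihh ihj =>
    intro e he
    cases e with
    | crec p' h' j' =>
      simp only [index, Nat.pair_eq_pair, true_and] at he
      obtain ⟨rfl, h₁, h₂, h₃⟩ := he
      have h₄ := congrFun (Encodable.encode_injective h₁)
      rw [ihh _ h₂, ihj _ h₃, funext fun i => ihp i _ (h₄ i)]
    | _ => simp [index, Nat.pair_eq_pair] at he
  | _ =>
    intro g h
    cases g <;> first | rfl | simp [index, Nat.pair_eq_pair] at h

instance (n : ℕ) : Countable (ElemFn n) :=
  Function.Injective.countable (f := index) fun f g h => index_injective f g h

end ElemFn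

instance (n : ℕ) : Countable (ArithRel n) :=
  Function.Injective.countable (f := fun _ => ()) fun r s _ => by cases r; cases s; rfl

instance : Countable arith.Symbols :=
  inferInstanceAs (Countable ((Σ n, ElemFn n) ⊕ Σ n, ArithRel n))

instance : Countable (Σ n, arith.Functions n) :=
  inferInstanceAs (Countable (Σ n, ElemFn n))

/-- The predicate constants are indexed by operators, so the extended language is countable because
the arithmetical formulas and terms are. -/
instance : Countable AccOp :=
  Function.Injective.countable (f := fun φ : AccOp => (φ.θ, φ.t)) fun φ ψ h => by
    cases φ; cases ψ; simp at h; simp [h]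

/-- The operator of a predicate constant. -/
def IDRel.op : {n : ℕ} → IDRel n → Option AccOp
  | _, .lt => none
  | _, .fix φ => some φ

instance (n : ℕ) : Countable (IDRel n) :=
  Function.Injective.countable (f := IDRel.op) fun r s h => by
    cases r <;> cases s <;> simp_all [IDRel.op]

instance : Countable LID.Symbols :=
  inferInstanceAs (Countable ((Σ n, ElemFn n) ⊕ Σ n, IDRel n))

/-! ### Models of the theory -/

/-- Models of `Acc-ID(Acc)`. -/
class AccModel (M : Type) extends LID.Structure M where
  sat : ∀ φ ∈ AccID, ∀ v : ℕ → M, φ.Realize v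

theorem provable_of_forall_accModel {φ : Fm}
    (h : ∀ (M : Type) [AccModel M] (v : ℕ → M), φ.Realize v) : Provable AccID φ :=
  provable_of_forall_model fun M _ hM v =>
    let : AccModel M := ⟨hM⟩
    h M v

section Model

variable {M : Type} [AccModel M]

/-- The value of a function constant. -/
def F {n : ℕ} (f : ElemFn n) (xs : Fin n → M) : M := Structure.funMap (L := LID) f xs

/-- The interpretation of `R_φ`. -/
def Rel (φ : AccOp) (a : M) : Prop := Structure.RelMap (L := LID) (IDRel.fix φ) ![a]

instance : LT M := ⟨fun a b => Structure.RelMap (L := LID) IDRel.lt ![a, b]⟩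
instance : Zero M := ⟨F .zero ![]⟩
instance : Add M := ⟨fun a b => F .add ![a, b]⟩
instance : Mul M := ⟨fun a b => F .mul ![a, b]⟩
instance : Sub M := ⟨fun a b => F .monus ![a, b]⟩

/-- The successor function. -/
def S (a : M) : M := F .succ ![a]

/-- The pairing function. -/
def pr (a b : M) : M := F .pair ![a, b]

def fs (a : M) : M := F .fst ![a]
def sn (a : M) : M := F .snd ![a]

/-- The assignment of `a` to the variable `0` and of `b` to all others. -/
def asg (a b : M) : ℕ → M
  | 0 => a
  | _ => b

theorem realize_fn {n : ℕ} (f : ElemFn n) (ts : Fin n → Tm) (v : ℕ → M) :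
    (fn f ts).realize v = F f (fun i => (ts i).realize v) := rfl

theorem realize_v (i : ℕ) (v : ℕ → M) : (WeakID.v i).realize v = v i := rfl

theorem F_nil (f : ElemFn 0) (ts : Fin 0 → Tm) (v : ℕ → M) :
    F f (fun i => (ts i).realize v) = F f ![] := by
  congr 1; funext i; exact i.elim0

theorem F_one (f : ElemFn 1) (s : Tm) (v : ℕ → M) :
    F f (fun i => ((![s] : Fin 1 → Tm) i).realize v) = F f ![s.realize v] := by
  congr 1; funext i; fin_cases i; rfl

theorem F_two (f : ElemFn 2) (s t : Tm) (v : ℕ → M) :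
    F f (fun i => ((![s, t] : Fin 2 → Tm) i).realize v) = F f ![s.realize v, t.realize v] := by
  congr 1; funext i; fin_cases i <;> rfl

section
variable (s t : Tm) (v : ℕ → M)
theorem realize_zeroT : zeroT.realize v = (0 : M) := by rw [zeroT, realize_fn, F_nil]; rfl
theorem realize_succT : (succT s).realize v = S (s.realize v) := by
  rw [succT, realize_fn, F_one]; rfl
theorem realize_addT : (addT s t).realize v = s.realize v + t.realize v := by
  rw [addT, realize_fn, F_two]; rfl
theorem realize_mulT : (mulT s t).realize v = s.realize v * t.realize v := by
  rw [mulT, realize_fn, F_two]; rfl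
theorem realize_monusT : (monusT s t).realize v = s.realize v - t.realize v := by
  rw [monusT, realize_fn, F_two]; rfl
theorem realize_pairT : (pairT s t).realize v = pr (s.realize v) (t.realize v) := by
  rw [pairT, realize_fn, F_two]; rfl
theorem realize_ltA : (ltA s t).Realize v ↔ s.realize v < t.realize v := by
  rw [ltA, Formula.realize_rel₂]; rfl
theorem realize_inR (φ : AccOp) : (inR φ t).Realize v ↔ Rel φ (t.realize v) := by
  rw [inR, Formula.realize_rel₁]; rfl
end

theorem DefAx.realize {φ : Fm} (h : DefAx φ) (v : ℕ → M) : φ.Realize v :=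
  AccModel.sat φ (.ea (.defAx h)) v


end Model

section Model

variable {M : Type} [AccModel M]

instance : arith.Structure M := incl.reduct M

instance : incl.IsExpansionOn M := LHom.isExpansionOn_reduct incl M

/-! ### Quantifier-free definable relations -/

/-- `t` is given by a term with parameters. -/
class TermDef (t : M → M → M) : Prop where
  out : ∃ s : arith.Term (M ⊕ Fin 2), ∀ x y, t x y = s.realize (Sum.elim id ![x, y])

/-- `P` is given by a quantifier-free formula with parameters. -/
class QFDef (P : M → M → Prop) : Prop where
  out : ∃ θ : arith.Formula (M ⊕ Fin 2), BoundedFormula.IsQF θ ∧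
    ∀ x y, P x y ↔ θ.Realize (Sum.elim id ![x, y])

namespace TermDef

instance const (a : M) : TermDef (fun _ _ => a) := ⟨Term.var (Sum.inl a), fun _ _ => rfl⟩
instance left : TermDef (fun x _ : M => x) := ⟨Term.var (Sum.inr 0), fun _ _ => rfl⟩
instance right : TermDef (fun _ y : M => y) := ⟨Term.var (Sum.inr 1), fun _ _ => rfl⟩

/-- The instances built on this let class inference find the formula behind a predicate on the
model, so that an axiom scheme can be applied to the predicate directly. -/
theorem app {n : ℕ} (f : ElemFn n) {ts : Fin n → M → M → M} (h : ∀ i, TermDef (ts i)) :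
    TermDef (fun x y => F f (fun i => ts i x y)) := by
  choose ss hs using fun i => (h i).out
  refine ⟨Term.func (L := arith) f ss, fun x y => ?_⟩
  simp only [hs]
  rfl

instance app₁ (f : ElemFn 1) (s : M → M → M) [hs : TermDef s] :
    TermDef (fun x y => F f ![s x y]) := by
  have := app f (ts := ![s]) (by intro i; fin_cases i; exact hs)
  convert this using 3
  congr 1; funext i; fin_cases i; rfl

instance app₂ (f : ElemFn 2) (s t : M → M → M) [hs : TermDef s] [ht : TermDef t] :
    TermDef (fun x y => F f ![s x y, t x y]) := by
  have := app f (ts := ![s, t]) (by intro i; fin_cases i; exacts [hs, ht])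
  convert this using 3
  congr 1; funext i; fin_cases i <;> rfl

variable (s t : M → M → M) [TermDef s] [TermDef t]

instance succ : TermDef (fun x y => S (s x y)) := app₁ .succ s
instance fs : TermDef (fun x y => fs (s x y)) := app₁ .fst s
instance sn : TermDef (fun x y => sn (s x y)) := app₁ .snd s
instance add : TermDef (fun x y => s x y + t x y) := app₂ .add s t
instance mul : TermDef (fun x y => s x y * t x y) := app₂ .mul s t
instance sub : TermDef (fun x y => s x y - t x y) := app₂ .monus s t
instance pr : TermDef (fun x y => pr (s x y) (t x y)) := app₂ .pair s t

end TermDef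

namespace QFDef

section
variable (s t : M → M → M) [hs : TermDef s] [ht : TermDef t]

instance eq : QFDef (fun x y => s x y = t x y) := by
  obtain ⟨s', hs⟩ := hs
  obtain ⟨t', ht⟩ := ht
  refine ⟨s'.equal t', .of_isAtomic (.equal _ _), fun x y => ?_⟩
  rw [Formula.realize_equal, hs, ht]

instance lt : QFDef (fun x y => s x y < t x y) := by
  obtain ⟨s', hs⟩ := hs
  obtain ⟨t', ht⟩ := ht
  refine ⟨Relations.formula₂ (L := arith) ArithRel.lt s' t', .of_isAtomic (.rel _ _),
    fun x y => ?_⟩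
  rw [Formula.realize_rel₂, hs, ht]
  rfl
end

section
variable (P Q : M → M → Prop) [hP : QFDef P] [hQ : QFDef Q]

instance imp : QFDef (fun x y => P x y → Q x y) := by
  obtain ⟨θ, h, hP⟩ := hP
  obtain ⟨η, h', hQ⟩ := hQ
  refine ⟨θ ⟹ η, h.imp h', fun x y => ?_⟩
  rw [Formula.realize_imp, hP, hQ]

instance not : QFDef (fun x y => ¬ P x y) := by
  obtain ⟨θ, h, hP⟩ := hP
  refine ⟨∼θ, h.not, fun x y => ?_⟩
  rw [Formula.realize_not, hP]

instance and : QFDef (fun x y => P x y ∧ Q x y) := by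
  have := not (fun x y => P x y → ¬ Q x y)
  simpa using this

instance or : QFDef (fun x y => P x y ∨ Q x y) := by
  have := imp (fun x y => ¬ P x y) Q
  simpa [or_iff_not_imp_left] using this
end

theorem isQF_subst {α β : Type} {θ : arith.Formula α} (hθ : BoundedFormula.IsQF θ)
    (f : α → arith.Term β) : BoundedFormula.IsQF (BoundedFormula.subst θ f) := by
  induction hθ with
  | falsum => exact .falsum
  | of_isAtomic h =>
    cases h with
    | equal => exact .of_isAtomic (.equal _ _)
    | rel => exact .of_isAtomic (.rel _ _)
  | imp _ _ h₁ h₂ => exact .imp h₁ h₂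

/-- The parameters of a definition are made values of variables. -/
theorem exists_formula {P : M → M → Prop} (hP : QFDef P) : ∃ (θ : arith.Formula ℕ) (w : ℕ → M),
    BoundedFormula.IsQF θ ∧ ∀ v : ℕ → M, (∀ i, v (i + 2) = w (i + 2)) →
      (P (v 0) (v 1) ↔ θ.Realize v) := by
  classical
  obtain ⟨θ, hθ, hP⟩ := hP.out
  obtain ⟨l, hl⟩ : ∃ l : List M, ∀ a, Sum.inl a ∈ BoundedFormula.freeVarFinset θ → a ∈ l :=
    ⟨(BoundedFormula.freeVarFinset θ).toList.filterMap Sum.getLeft?, fun a ha => by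
      rw [List.mem_filterMap]; exact ⟨Sum.inl a, by simpa using ha, rfl⟩⟩
  -- Variables `0` and `1` are kept for the two arguments; the parameter at position `i` of the list
  -- becomes variable `i + 2`.
  let f : M ⊕ Fin 2 → ℕ := Sum.elim (fun a => l.idxOf a + 2) (fun i => i)
  refine ⟨θ.subst (fun a => Term.var (f a)), fun i => l.getD (i - 2) 0, ?_, fun v hv => ?_⟩
  · exact isQF_subst hθ _
  · rw [hP, Formula.Realize, Formula.Realize, BoundedFormula.realize_subst]
    refine realize_congr _ _ fun a ha => ?_
    rcases a with a | i
    · have h₁ := hl a ha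
      simp only [Term.realize, f, Sum.elim_inl, hv]
      simp [List.getD_eq_getElem?_getD, h₁]
    · fin_cases i <;> rfl

end QFDef

theorem IsBounded.of_isQF {α : Type} {n : ℕ} {θ : arith.BoundedFormula α n}
    (h : BoundedFormula.IsQF θ) : IsBounded θ := by
  induction h with
  | falsum => exact .falsum
  | of_isAtomic h =>
    cases h with
    | equal => exact .equal _ _
    | rel R ts =>
      cases R
      have : ts = ![ts 0, ts 1] := by funext i; fin_cases i <;> rfl
      rw [this]
      exact .lt _ _
  | imp _ _ h₁ h₂ => exact .imp h₁ h₂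

/-! ### Induction -/

theorem realize_indAx (σ : Fm) (x : ℕ) (v : ℕ → M) (h : (indAx σ x).Realize v)
    (h0 : σ.Realize (Function.update v x 0))
    (hS : ∀ a, σ.Realize (Function.update v x a) → σ.Realize (Function.update v x (S a))) (a : M) :
    σ.Realize (Function.update v x a) := by
  rw [indAx, Formula.realize_imp, Formula.realize_inf, realize_allVar, realize_allVar,
    realize_substVar, realize_zeroT] at h
  refine h ⟨h0, fun b => ?_⟩ a
  rw [Formula.realize_imp, realize_substVar, realize_succT, realize_v, Function.update_self,
    Function.update_idem]
  exact hS b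

theorem bounded_induction {θ : arith.Formula ℕ} (hθ : IsBounded θ) (v : ℕ → M)
    (h0 : θ.Realize (Function.update v 0 0))
    (hS : ∀ a, θ.Realize (Function.update v 0 a) → θ.Realize (Function.update v 0 (S a))) (a : M) :
    θ.Realize (Function.update v 0 a) := by
  have := realize_indAx (incl.onFormula θ) 0 v (AccModel.sat _ (.ea (.ind θ 0 hθ)) v)
  simp only [LHom.realize_onFormula] at this
  exact this h0 hS a

theorem induction (P : M → Prop) [hP : QFDef fun x _ => P x] (h0 : P 0)
    (hS : ∀ x, P x → P (S x)) (x : M) : P x := by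
  obtain ⟨θ, w, hθ, h⟩ := hP.exists_formula
  have key : ∀ a, P a ↔ θ.Realize (Function.update w 0 a) := fun a =>
    h (Function.update w 0 a) (fun i => by simp)
  simp only [key] at *
  exact bounded_induction (.of_isQF hθ) w h0 hS x

/-- Variable `0` plays two roles: inside `θ` it is turned into the bound variable, while the free
occurrence that remains is the bound of the quantifier. -/
theorem realize_ball (θ : arith.Formula ℕ) (v : ℕ → M) :
    Formula.Realize (∀' (Relations.boundedFormula₂ (L := arith) ArithRel.lt
      (&(Fin.last 0)) ((Term.var (Sum.inl 0) : arith.Term (ℕ ⊕ Fin 0)).relabel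
        (Sum.map id Fin.castSucc)) ⟹
      (BoundedFormula.relabel (fun i => if i = 0 then Sum.inr (0 : Fin 1) else Sum.inl i) θ :
        arith.BoundedFormula ℕ 1))) v ↔
    ∀ z, z < v 0 → θ.Realize (Function.update v 0 z) := by
  simp only [Formula.Realize, BoundedFormula.realize_all, BoundedFormula.realize_imp,
    BoundedFormula.realize_rel₂]
  refine forall_congr' fun z => imp_congr Iff.rfl ?_
  rw [BoundedFormula.realize_relabel (n := 0) (m := 1)]
  have : (Sum.elim v ((Fin.snoc default z : Fin 1 → M) ∘ Fin.castAdd 0) ∘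
      fun i => if i = 0 then Sum.inr (0 : Fin 1) else Sum.inl i) = Function.update v 0 z := by
    funext i
    by_cases h : i = 0
    · subst h; simp [Fin.snoc]
    · simp [h]
  rw [this]
  exact iff_of_eq (congrArg _ (Subsingleton.elim _ _))

/-- Course-of-values induction needs induction for `∀ z < x, P z`, which is no longer
quantifier-free but still bounded. -/
theorem strong_induction_aux (P : M → Prop) [hP : QFDef fun x _ => P x]
    (h0 : ∀ z : M, z < 0 → P z)
    (hS : ∀ x, (∀ z, z < x → P z) → ∀ z, z < S x → P z) (x : M) : ∀ z, z < x → P z := by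
  obtain ⟨θ, w, hθ, h⟩ := hP.exists_formula
  have key : ∀ a, P a ↔ θ.Realize (Function.update w 0 a) := fun a =>
    h (Function.update w 0 a) (fun i => by simp)
  have hb := IsBounded.ball (n := 0) (Term.var (Sum.inl 0) : arith.Term (ℕ ⊕ Fin 0))
    (IsBounded.of_isQF (hθ.relabel
      (fun i => if i = 0 then Sum.inr (0 : Fin 1) else Sum.inl i)))
  have hb' := bounded_induction hb w
  simp only [realize_ball, Function.update_self, Function.update_idem, ← key] at hb'
  exact hb' h0 hS x

/-- `Acc` formulas whose term is just the quantified variable are enough: values of other terms can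
be described inside `Θ` by an equation. -/
theorem exists_isAcc (φ : AccOp) {Θ : M → M → Prop} (hΘ : QFDef Θ) :
    ∃ (σ : Fm) (w : ℕ → M), IsAcc σ ∧ ∀ v : ℕ → M, (∀ i, v (i + 2) = w (i + 2)) →
      (σ.Realize v ↔ ∀ y, Θ (v 0) y → Rel φ y) := by
  obtain ⟨θ, w, hθ, h⟩ := hΘ.exists_formula
  refine ⟨allVar 1 (incl.onFormula θ ⟹ inR φ (WeakID.v 1)), w,
    ⟨1, θ, WeakID.v 1, φ, .of_isQF hθ, rfl⟩, fun v hv => ?_⟩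
  rw [realize_allVar]
  refine forall_congr' fun y => ?_
  rw [Formula.realize_imp, realize_inR, LHom.realize_onFormula, realize_v, Function.update_self,
    ← h (Function.update v 1 y) (fun i => by simp [hv])]
  simp

/-- Induction for `∀ y (Θ(x, y) → R_φ(y))`. -/
theorem acc_induction (φ : AccOp) (Θ : M → M → Prop) [hΘ : QFDef Θ]
    (h0 : ∀ y, Θ 0 y → Rel φ y)
    (hS : ∀ x, (∀ y, Θ x y → Rel φ y) → ∀ y, Θ (S x) y → Rel φ y) (x : M) :
    ∀ y, Θ x y → Rel φ y := by
  obtain ⟨σ, w, hσ, h⟩ := exists_isAcc φ hΘ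
  have := realize_indAx σ 0 w (AccModel.sat _ (.ind σ 0 hσ) w)
  have key : ∀ a, σ.Realize (Function.update w 0 a) ↔ ∀ y, Θ a y → Rel φ y := fun a =>
    h (Function.update w 0 a) (fun i => by simp)
  simp only [key] at this
  exact this h0 hS x

/-! ### The accessible part -/

/-- `x ≺ y` -/
def Prec (x y : M) : Prop := F .prec ![x, y] = S 0

/-- `x ∈ W` -/
def W (x : M) : Prop := Rel accPrec x

theorem realize_inW (t : Tm) (v : ℕ → M) : (inW t).Realize v ↔ W (t.realize v) :=
  realize_inR t v accPrec

theorem realize_precA (s t : Tm) (v : ℕ → M) :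
    (precA s t).Realize v ↔ Prec (s.realize v) (t.realize v) := by
  rw [precA, Formula.realize_equal, realize_fn, F_two, realize_succT, realize_zeroT]
  rfl

theorem realize_precFormula (v : Fin 2 → M) : precFormula.Realize v ↔ Prec (v 1) (v 0) := by
  have h₁ : Term.realize v (Term.func (L := arith) ElemFn.prec
      ![Term.var 1, Term.var 0]) = F .prec ![v 1, v 0] := by
    change F _ _ = _
    congr 1
    funext i
    fin_cases i <;> rfl
  have h₂ : Term.realize v (Term.func (L := arith) ElemFn.succ
      ![(Term.func (L := arith) ElemFn.zero ![])]) = S 0 := by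
    change F _ _ = _
    congr 1
    funext i
    obtain rfl := Fin.fin_one_eq_zero i
    change F _ _ = F _ _
    congr 1
    funext i
    exact i.elim0
  rw [Prec, ← h₁, ← h₂]
  have h₃ : ∀ (s t : arith.Term (Fin 2)), (s.equal t).Realize v ↔ s.realize v = t.realize v :=
    fun s t => Formula.realize_equal
  rw [← h₃]
  refine iff_of_eq (congrArg (fun φ : arith.Formula (Fin 2) => φ.Realize v) ?_)
  simp only [precFormula, Term.equal, Term.bdEqual, Term.relabel]
  congr 2
  · funext i; fin_cases i <;> rfl
  · funext i
    obtain rfl := Fin.fin_one_eq_zero i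
    simp [Term.relabel]
    funext i
    exact i.elim0

theorem realize_applyTo (σ : Fm) (x y : ℕ) (s : Tm) (v : ℕ → M) (hs : y ∉ s.varFinset) :
    (accPrec.applyTo σ x y s).Realize v ↔ ∀ a, Prec a (s.realize v) →
      σ.Realize (Function.update (Function.update v y a) x a) := by
  rw [AccOp.applyTo, realize_allVar]
  refine forall_congr' fun a => ?_
  have hs' : s.realize (Function.update v y a) = s.realize v := by
    clear * - hs
    induction s with
    | var i =>
      have : i ≠ y := fun h => hs (by simp [h])
      simp [this]
    | func f ts ih =>
      simp only [Term.realize]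
      congr 1
      funext i
      exact ih i fun h => hs (by simp; exact ⟨i, h⟩)
  rw [Formula.realize_imp]
  refine imp_congr ?_ ?_
  · rw [Formula.Realize, BoundedFormula.realize_subst]
    have := LHom.realize_onFormula (M := M) incl accPrec.θ
      (v := fun i => (![s, WeakID.v y] i).realize (Function.update v y a))
    refine this.trans ((realize_precFormula _).trans ?_)
    simp [realize_v, hs']
  · rw [realize_substVar]
    have : (((incl.onTerm accPrec.t).subst ![s, WeakID.v y]).realize (Function.update v y a)) =
        a := by
      simp [accPrec, LHom.onTerm, Term.subst, realize_v]
    rw [this]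

theorem W_of_forall_prec {x : M} (h : ∀ y, Prec y x → W y) : W x := by
  have h₁ := (realize_allVar 0 _ (fun _ => x)).1 (AccModel.sat _ (.closed accPrec) _) x
  rw [Formula.realize_imp, realize_applyTo _ _ _ _ _ (by simp [WeakID.v])] at h₁
  simp only [realize_inR, realize_v, Function.update_self] at h₁
  exact h₁ h

/-- The leastness axiom for the accessible part, read in the model for the predicate `∀ y (Θ(x, y) →
y ∈ W)`. -/
theorem W_induction_aux (Θ : M → M → Prop) [hΘ : QFDef Θ]
    (h : ∀ x, (∀ z, Prec z x → ∀ y, Θ z y → W y) → ∀ y, Θ x y → W y) {x : M} (hx : W x) :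
    ∀ y, Θ x y → W y := by
  obtain ⟨σ, w, hσ, hw⟩ := exists_isAcc accPrec hΘ
  obtain ⟨u, hu⟩ := Infinite.exists_notMem_finset (BoundedFormula.freeVarFinset σ ∪ {0})
  simp only [Finset.mem_union, Finset.mem_singleton, not_or] at hu
  have hx₀ := (realize_allVar u _ w).1
    -- One fresh variable can serve both as the element of `W` and as the quantified variable of the
    -- operator, since the scope of the latter does not mention the former.
    (AccModel.sat _ (.least accPrec σ 0 u u hσ (Ne.symm hu.2) (Ne.symm hu.2) hu.1 hu.1) w) x
  have key : ∀ a b, σ.Realize (Function.update (Function.update w u b) 0 a) ↔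
      ∀ y, Θ a y → W y := by
    intro a b
    have h₁ := hw (Function.update w 0 a) (fun i => by simp)
    simp only [Function.update_self] at h₁
    refine Iff.trans ?_ h₁
    refine realize_congr σ _ fun i hi => ?_
    have : i ≠ u := fun h => hu.1 (h ▸ hi)
    by_cases h0 : i = 0
    · subst h0; simp
    · simp [this, h0]
  rw [Formula.realize_imp, Formula.realize_imp, realize_substVar, realize_allVar, realize_inR,
    realize_v, Function.update_self, key] at hx₀
  refine hx₀ hx fun a => ?_
  rw [Formula.realize_imp, realize_applyTo _ _ _ _ _ (by simp [WeakID.v, hu.2]), key]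
  intro h₁
  refine h a fun z hz => ?_
  have h₂ := h₁ z (by simpa [realize_v] using hz)
  rw [Function.update_comm (β := fun _ => M) (Ne.symm hu.2) a z, Function.update_idem, Function.update_idem, key] at h₂
  exact h₂

end Model

section Model

variable {M : Type} [AccModel M]

/-! ### Arithmetic in a model -/

section
variable (a b : M)

theorem S_ne_zero : S a ≠ 0 := by
  have := DefAx.succ_ne_zero.realize (asg a a)
  simpa only [Formula.realize_not, Formula.realize_equal, realize_succT, realize_zeroT, realize_v,
    asg] using this

theorem S_inj (h : S a = S b) : a = b := by
  have := DefAx.succ_inj.realize (asg a b)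
  simp only [Formula.realize_imp, Formula.realize_equal, realize_succT, realize_v, asg] at this
  exact this h

theorem not_lt_zero' : ¬ a < 0 := by
  have := DefAx.not_lt_zero.realize (asg a a)
  simpa only [Formula.realize_not, realize_ltA, realize_zeroT, realize_v, asg] using this

theorem lt_S_iff : a < S b ↔ a < b ∨ a = b := by
  have := DefAx.lt_succ.realize (asg a b)
  simpa only [Formula.realize_iff, Formula.realize_sup, Formula.realize_equal, realize_ltA,
    realize_succT, realize_v, asg] using this

theorem add_zero' : a + 0 = a := by
  have := DefAx.add_zero.realize (asg a a)
  simpa only [Formula.realize_equal, realize_addT, realize_zeroT, realize_v, asg] using this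

theorem add_S : a + S b = S (a + b) := by
  have := DefAx.add_succ.realize (asg a b)
  simpa only [Formula.realize_equal, realize_addT, realize_succT, realize_v, asg] using this

theorem mul_zero' : a * 0 = 0 := by
  have := DefAx.mul_zero.realize (asg a a)
  simpa only [Formula.realize_equal, realize_mulT, realize_zeroT, realize_v, asg] using this

theorem mul_S : a * S b = a * b + a := by
  have := DefAx.mul_succ.realize (asg a b)
  simpa only [Formula.realize_equal, realize_addT, realize_mulT, realize_succT, realize_v, asg]
    using this

theorem sub_zero' : a - 0 = a := by
  have := DefAx.monus_zero.realize (asg a a)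
  simpa only [Formula.realize_equal, realize_monusT, realize_zeroT, realize_v, asg] using this

theorem zero_sub' : 0 - a = 0 := by
  have := DefAx.zero_monus.realize (asg a a)
  simpa only [Formula.realize_equal, realize_monusT, realize_zeroT, realize_v, asg] using this

theorem S_sub_S : S a - S b = a - b := by
  have := DefAx.succ_monus.realize (asg a b)
  simpa only [Formula.realize_equal, realize_monusT, realize_succT, realize_v, asg] using this

theorem pr_of_lt (h : a < b) : pr a b = b * b + a := by
  have := DefAx.pair_lt.realize (asg a b)
  simp only [Formula.realize_imp, Formula.realize_equal, realize_ltA, realize_pairT, realize_addT,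
    realize_mulT, realize_v, asg] at this
  exact this h

theorem pr_of_not_lt (h : ¬ a < b) : pr a b = a * a + a + b := by
  have := DefAx.pair_ge.realize (asg a b)
  simp only [Formula.realize_imp, Formula.realize_not, Formula.realize_equal, realize_ltA,
    realize_pairT, realize_addT, realize_mulT, realize_v, asg] at this
  exact this h

theorem pr_fs_sn : pr (fs a) (sn a) = a := by
  have := DefAx.fst_snd.realize (asg a a)
  rw [Formula.realize_equal, realize_pairT, realize_fn, realize_fn, F_one, F_one] at this
  exact this

end

theorem zero_add' (a : M) : 0 + a = a :=
  induction (fun a : M => 0 + a = a) (add_zero' 0) (fun a h => by rw [add_S, h]) a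

theorem S_add (a b : M) : S a + b = S (a + b) :=
  induction (fun b : M => S a + b = S (a + b)) (by rw [add_zero' _, add_zero' _])
    (fun b h => by rw [add_S, h, add_S]) b

theorem add_comm' (a b : M) : a + b = b + a :=
  induction (fun b : M => a + b = b + a) (by rw [add_zero' _, zero_add'])
    (fun b h => by rw [add_S, h, S_add]) b

theorem add_assoc' (a b c : M) : a + b + c = a + (b + c) :=
  induction (fun c : M => a + b + c = a + (b + c)) (by rw [add_zero' _, add_zero' _])
    (fun c h => by rw [add_S, h, add_S, add_S]) c

theorem zero_mul' (a : M) : 0 * a = 0 :=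
  induction (fun a : M => 0 * a = 0) (mul_zero' 0) (fun a h => by rw [mul_S, h, add_zero' _]) a

theorem S_mul (a b : M) : S a * b = a * b + b :=
  induction (fun b : M => S a * b = a * b + b)
    (by rw [mul_zero' _, mul_zero' _, add_zero' _])
    (fun b h => by
      rw [mul_S, h, mul_S, add_S, add_S, add_assoc', add_assoc', add_comm' b a]) b

theorem mul_comm' (a b : M) : a * b = b * a :=
  induction (fun b : M => a * b = b * a) (by rw [mul_zero' _, zero_mul'])
    (fun b h => by rw [mul_S, h, S_mul]) b

theorem mul_add' (a b c : M) : a * (b + c) = a * b + a * c :=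
  induction (fun c : M => a * (b + c) = a * b + a * c)
    (by rw [add_zero' _, mul_zero' _, add_zero' _])
    (fun c h => by rw [add_S, mul_S, mul_S, h, add_assoc']) c

theorem mul_assoc' (a b c : M) : a * b * c = a * (b * c) :=
  induction (fun c : M => a * b * c = a * (b * c))
    (by rw [mul_zero' _, mul_zero' _, mul_zero' _])
    (fun c h => by rw [mul_S, mul_S, mul_add', h]) c

theorem mul_one' (a : M) : a * S 0 = a := by rw [mul_S, mul_zero' _, zero_add']

instance : One M := ⟨S 0⟩

theorem S_zero : S (0 : M) = 1 := rfl

instance : CommSemiring M where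
  add_assoc := add_assoc'
  zero_add := zero_add'
  add_zero a := add_zero' a
  add_comm := add_comm'
  left_distrib := mul_add'
  right_distrib a b c := by rw [mul_comm', mul_add', mul_comm' a, mul_comm' b]
  zero_mul := zero_mul'
  mul_zero a := mul_zero' a
  mul_assoc := mul_assoc'
  one_mul a := by rw [mul_comm']; exact mul_one' a
  mul_one := mul_one'
  mul_comm := mul_comm'
  nsmul := nsmulRec

theorem S_eq (a : M) : S a = a + 1 := by rw [← S_zero, add_S, add_zero]

/-- Naming the predecessor by truncated subtraction keeps the induction formula quantifier-free. -/
theorem eq_zero_or_S (a : M) : a = 0 ∨ a = S (a - 1) :=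
  induction (fun a : M => a = 0 ∨ a = S (a - 1)) (.inl rfl)
    (fun a _ => .inr (by rw [← S_zero, S_sub_S, sub_zero' _])) a

theorem add_left_cancel' (a b c : M) : a + b = a + c → b = c :=
  induction (fun a : M => a + b = a + c → b = c) (by simp)
    (fun a h h' => by rw [S_add, S_add] at h'; exact h (S_inj _ _ h')) a

theorem add_sub_self (a b : M) : a + b - a = b :=
  induction (fun a : M => a + b - a = b) (by rw [zero_add, sub_zero' _])
    (fun a h => by rw [S_add, S_sub_S, h]) a

theorem sub_add_self (a b : M) : a - (a + b) = 0 :=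
  induction (fun a : M => a - (a + b) = 0) (zero_sub' _)
    (fun a h => by rw [S_add, S_sub_S, h]) a

theorem lt_add_S (a b : M) : a < a + S b :=
  induction (fun b : M => a < a + S b) (by rw [add_S, add_zero, lt_S_iff]; exact .inr rfl)
    (fun b h => by rw [add_S, lt_S_iff]; exact .inl h) b

/-- Existence of a difference is not a quantifier-free statement; the explicit term for the
difference turns it into one. -/
theorem eq_add_of_lt (a b : M) : a < b → b = a + S (b - S a) :=
  induction (fun b : M => a < b → b = a + S (b - S a)) (fun h => (not_lt_zero' a h).elim)
    (fun b ih h => by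
      rw [S_sub_S]
      rcases (lt_S_iff a b).1 h with h | rfl
      · have h₁ := ih h
        rw [h₁, add_sub_self, ← add_S]
      · rw [show a - a = 0 by simpa using sub_add_self a 0, add_S, add_zero]) b

theorem lt_iff_exists (a b : M) : a < b ↔ ∃ c, b = a + c + 1 :=
  ⟨fun h => ⟨b - S a, by rw [add_assoc, ← S_eq]; exact eq_add_of_lt a b h⟩,
    fun ⟨c, h⟩ => by rw [h, add_assoc, ← S_eq]; exact lt_add_S a c⟩

theorem add_one_ne_zero (a : M) : a + 1 ≠ 0 := by rw [← S_eq]; exact S_ne_zero a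

theorem trichotomy (a b : M) : a < b ∨ a = b ∨ b < a :=
  induction (fun b : M => a < b ∨ a = b ∨ b < a)
    (by
      rcases eq_zero_or_S a with h | h
      · exact .inr (.inl h)
      · exact .inr (.inr (by rw [lt_iff_exists]; exact ⟨a - 1, by rwa [zero_add, ← S_eq]⟩)))
    (fun b ih => by
      rcases ih with h | h | h
      · exact .inl ((lt_S_iff _ _).2 (.inl h))
      · exact .inl ((lt_S_iff _ _).2 (.inr h))
      · obtain ⟨c, rfl⟩ := (lt_iff_exists _ _).1 h
        rcases eq_zero_or_S c with rfl | hc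
        · exact .inr (.inl (by rw [S_eq, add_zero]))
        · refine .inr (.inr ((lt_iff_exists _ _).2 ⟨c - 1, ?_⟩))
          generalize c - 1 = d at hc
          rw [hc, S_eq, S_eq]
          ring) b

/-- The language has only `<` as a symbol. The additive definition of `≤` is matched with it below,
so that the general theory of ordered semirings applies to the model. -/
instance : LE M := ⟨fun a b => ∃ c, b = a + c⟩

theorem le_def (a b : M) : a ≤ b ↔ ∃ c, b = a + c := Iff.rfl

theorem lt_iff_succ_le (a b : M) : a < b ↔ a + 1 ≤ b := by
  rw [lt_iff_exists, le_def]
  exact exists_congr fun c => by rw [add_right_comm]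

theorem le_antisymm' (a b : M) (h : a ≤ b) (h' : b ≤ a) : a = b := by
  obtain ⟨c, rfl⟩ := h
  obtain ⟨d, h⟩ := h'
  have h₁ : 0 = c + d := add_left_cancel' a 0 (c + d) (by rw [add_zero, ← add_assoc]; exact h)
  rcases eq_zero_or_S c with rfl | hc
  · rw [add_zero]
  · rw [hc, S_add] at h₁
    exact (S_ne_zero _ h₁.symm).elim

noncomputable instance : LinearOrder M where
  le_refl a := ⟨0, (add_zero a).symm⟩
  le_trans := by
    rintro a _ _ ⟨c, rfl⟩ ⟨d, rfl⟩
    exact ⟨c + d, add_assoc _ _ _⟩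
  lt_iff_le_not_ge a b := by
    constructor
    · intro h
      obtain ⟨c, rfl⟩ := (lt_iff_exists _ _).1 h
      refine ⟨⟨c + 1, add_assoc _ _ _⟩, fun ⟨d, hd⟩ => ?_⟩
      have := add_left_cancel' a 0 (c + d + 1) (by rw [add_zero]; conv_lhs => rw [hd]
                                                   ring)
      exact add_one_ne_zero _ this.symm
    · rintro ⟨⟨c, rfl⟩, h⟩
      rcases eq_zero_or_S c with rfl | hc
      · exact (h ⟨0, by simp⟩).elim
      · rw [hc]; exact lt_add_S _ _
  le_antisymm := le_antisymm'
  le_total a b := by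
    rcases trichotomy a b with h | rfl | h
    · obtain ⟨c, rfl⟩ := (lt_iff_exists _ _).1 h
      exact .inl ⟨c + 1, add_assoc _ _ _⟩
    · exact .inl ⟨0, (add_zero _).symm⟩
    · obtain ⟨c, rfl⟩ := (lt_iff_exists _ _).1 h
      exact .inr ⟨c + 1, add_assoc _ _ _⟩
  toDecidableLE := Classical.decRel _

instance : IsOrderedRing M where
  add_le_add_left a b h c := by
    obtain ⟨d, rfl⟩ := h
    exact ⟨d, by ring⟩
  zero_le_one := ⟨1, (zero_add 1).symm⟩
  mul_le_mul_of_nonneg_left a _ b c h := by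
    obtain ⟨d, rfl⟩ := h
    exact ⟨a * d, by ring⟩
  mul_le_mul_of_nonneg_right a _ b c h := by
    obtain ⟨d, rfl⟩ := h
    exact ⟨d * a, by ring⟩

theorem zero_le' (a : M) : 0 ≤ a := ⟨a, (zero_add a).symm⟩

theorem le_add_self' (a b : M) : a ≤ a + b := ⟨b, rfl⟩

theorem mul_mono {a b c d : M} (h : a ≤ c) (h' : b ≤ d) : a * b ≤ c * d :=
  mul_le_mul h h' (zero_le' _) (zero_le' _)

theorem sub_eq_zero_of_le {a b : M} (h : a ≤ b) : a - b = 0 := by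
  obtain ⟨c, rfl⟩ := h
  exact sub_add_self a c

theorem sub_eq_zero_iff {a b : M} : a - b = 0 ↔ a ≤ b := by
  refine ⟨fun h => ?_, sub_eq_zero_of_le⟩
  by_contra hn
  obtain ⟨c, rfl⟩ := (lt_iff_exists _ _).1 (not_le.1 hn)
  rw [add_assoc, add_sub_self] at h
  exact add_one_ne_zero _ h

theorem one_sub_of_ne_zero {a : M} (h : a ≠ 0) : 1 - a = 0 := by
  rcases eq_zero_or_S a with h' | h'
  · exact (h h').elim
  · rw [h', S_eq]
    exact sub_eq_zero_of_le ⟨a - 1, add_comm _ _⟩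

/-! ### Pairing -/

theorem pr_of_le {a b : M} (h : b ≤ a) : pr a b = a * a + a + b := pr_of_not_lt a b (not_lt.2 h)

/-- With `m = max a b`, the code of the pair lies in the interval from `m²` up to but not including
`(m + 1)²`. These intervals are disjoint, so the code determines `m`; this is what drives `pr_inj`.
-/
theorem sq_max_le_pr (a b : M) : max a b * max a b ≤ pr a b := by
  rcases lt_or_ge a b with h | h
  · rw [pr_of_lt a b h, max_eq_right h.le]
    exact le_add_self' _ _
  · rw [pr_of_le h, max_eq_left h, add_assoc]
    exact le_add_self' _ _

theorem pr_lt_sq_max (a b : M) : pr a b < (max a b + 1) * (max a b + 1) := by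
  rcases lt_or_ge a b with h | h
  · rw [pr_of_lt a b h, max_eq_right h.le, lt_iff_exists]
    obtain ⟨c, rfl⟩ := (lt_iff_exists _ _).1 h
    exact ⟨a + c + c + 1 + 1, by ring⟩
  · rw [pr_of_le h, max_eq_left h, lt_iff_exists]
    obtain ⟨c, rfl⟩ := h
    exact ⟨c, by ring⟩

theorem max_le_of_pr_le {a b c d : M} (h : pr a b ≤ pr c d) : max a b ≤ max c d := by
  by_contra hn
  have h₁ : max c d + 1 ≤ max a b := (lt_iff_succ_le _ _).1 (not_le.1 hn)
  have h₂ := mul_mono h₁ h₁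
  exact absurd ((pr_lt_sq_max c d).trans_le (h₂.trans (sq_max_le_pr a b))) (not_lt.2 h)

theorem pr_inj {a b c d : M} (h : pr a b = pr c d) : a = c ∧ b = d := by
  have hm : max a b = max c d := le_antisymm (max_le_of_pr_le h.le) (max_le_of_pr_le h.ge)
  rcases lt_or_ge a b with h₁ | h₁ <;> rcases lt_or_ge c d with h₂ | h₂
  · rw [max_eq_right h₁.le, max_eq_right h₂.le] at hm
    rw [pr_of_lt _ _ h₁, pr_of_lt _ _ h₂, hm] at h
    exact ⟨add_left_cancel' _ _ _ h, hm⟩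
  · rw [max_eq_right h₁.le, max_eq_left h₂] at hm
    rw [pr_of_lt _ _ h₁, pr_of_le h₂, hm, add_assoc] at h
    have := add_left_cancel' _ _ _ h
    rw [this, hm] at h₁
    exact absurd (le_add_self' c d) (not_le.2 h₁)
  · rw [max_eq_left h₁, max_eq_right h₂.le] at hm
    rw [pr_of_le h₁, pr_of_lt _ _ h₂, hm, add_assoc] at h
    have := add_left_cancel' _ _ _ h
    rw [← this] at h₂
    exact absurd (le_add_self' d b) (not_le.2 h₂)
  · rw [max_eq_left h₁, max_eq_left h₂] at hm
    rw [pr_of_le h₁, pr_of_le h₂, hm] at h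
    exact ⟨hm, add_left_cancel' _ _ _ h⟩

/-- The axiom only says that pairing the projections gives back the number; the projections of a
pair come from injectivity. -/
theorem fs_pr (a b : M) : fs (pr a b) = a := (pr_inj (pr_fs_sn (pr a b))).1

theorem sn_pr (a b : M) : sn (pr a b) = b := (pr_inj (pr_fs_sn (pr a b))).2

theorem pr_mono {a b c d : M} (h : a ≤ c) (h' : b ≤ d) : pr a b ≤ pr c d := by
  rcases lt_or_ge a b with h₁ | h₁ <;> rcases lt_or_ge c d with h₂ | h₂
  · rw [pr_of_lt _ _ h₁, pr_of_lt _ _ h₂]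
    exact add_le_add (mul_mono h' h') h
  · rw [pr_of_lt _ _ h₁, pr_of_le h₂]
    have h₃ := h'.trans h₂
    exact (add_le_add (mul_mono h₃ h₃) h).trans (le_add_self' _ _)
  · rw [pr_of_le h₁, pr_of_lt _ _ h₂]
    have h₃ := (lt_iff_succ_le _ _).1 h₂
    refine le_trans (add_le_add (add_le_add (mul_mono h h) h) (h₁.trans h)) ?_
    refine le_trans ?_ (add_le_add_left (mul_mono h₃ h₃) c)
    exact ⟨c + 1, by ring⟩
  · rw [pr_of_le h₁, pr_of_le h₂]
    exact add_le_add (add_le_add (mul_mono h h) h) h'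

theorem pr_lt_pr {a b c d : M} (h : a ≤ c) (h' : b ≤ d) (h₂ : a < c ∨ b < d) :
    pr a b < pr c d := by
  refine lt_of_le_of_ne (pr_mono h h') fun h₃ => ?_
  obtain ⟨rfl, rfl⟩ := pr_inj h₃
  exact h₂.elim (lt_irrefl _) (lt_irrefl _)

theorem le_mul_self (a : M) : a ≤ a * a := by
  rcases eq_zero_or_S a with h | h
  · rw [h]; exact zero_le' _
  · rw [h, S_eq]; exact ⟨(a - 1) * (a - 1) + (a - 1), by ring⟩

theorem max_le_pr (a b : M) : max a b ≤ pr a b := (le_mul_self _).trans (sq_max_le_pr a b)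

theorem left_le_pr (a b : M) : a ≤ pr a b := (le_max_left a b).trans (max_le_pr a b)

theorem right_le_pr (a b : M) : b ≤ pr a b := (le_max_right a b).trans (max_le_pr a b)

/-! ### Evaluation of the function constants -/

theorem F_proj {n : ℕ} (i : Fin n) (xs : Fin n → M) : F (.proj i) xs = xs i := by
  have := (DefAx.proj i).realize (fun j => if h : j < n then xs ⟨j, h⟩ else 0)
  simpa [Formula.realize_equal, realize_fn, vars, realize_v] using this

theorem F_comp {m n : ℕ} (f : ElemFn m) (g : Fin m → ElemFn n) (xs : Fin n → M) :
    F (.comp f g) xs = F f (fun i => F (g i) xs) := by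
  have := (DefAx.comp f g).realize (fun j => if h : j < n then xs ⟨j, h⟩ else 0)
  simpa [Formula.realize_equal, realize_fn, vars, realize_v] using this

/-- If the step function never exceeds the bound, the truncation `H - (H - J)` is just `H`, and the
limited recursion becomes a plain one. The remaining factor `1 - (S p - z)` is `1` when `p < z`. -/
theorem F_crec {n k : ℕ} (p : Fin k → ElemFn (n + 1)) (h : ElemFn (n + 1 + k))
    (j : ElemFn (n + 1)) (xs : Fin (n + 1) → M)
    (hle : ∀ ys, F h ys ≤ F j xs) :
    F (.crec p h j) xs = F h (Fin.append xs fun i => (1 - (S (F (p i) xs) - xs 0)) *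
      F (.crec p h j) (Fin.cons (F (p i) xs) (Fin.tail xs) : Fin (n + 1) → M)) := by
  let v : ℕ → M := fun j => if h : j < n + 1 then xs ⟨j, h⟩ else 0
  have hv : ∀ i : Fin (n + 1), (vars (n + 1) i).realize v = xs i := fun i => by
    have : (i : ℕ) < n + 1 := i.2
    simp only [vars, realize_v, v, dif_pos this]
  have := (DefAx.crec p h j).realize v
  rw [crecAx] at this
  simp only [Formula.realize_equal, realize_fn, realize_monusT] at this
  rw [sub_eq_zero_of_le (a := F h _) (b := F j _), sub_zero'] at this
  · simp only [hv] at this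
    rw [show F (.crec p h j) xs = F (.crec p h j) fun i => xs i from rfl, this]
    congr 1
    funext i
    refine Fin.addCases (fun i => ?_) (fun i => ?_) i
    · rw [Fin.append_left, Fin.append_left, hv]
    · rw [Fin.append_right, Fin.append_right, realize_mulT, realize_monusT, realize_monusT,
        realize_succT, realize_succT, realize_zeroT, realize_fn, realize_fn, realize_v]
      simp only [hv]
      congr 2
      funext l
      refine Fin.cases ?_ (fun l => ?_) l
      · simp only [Fin.cons_zero, realize_fn, hv]
      · simp only [Fin.cons_succ, Fin.tail, hv]
  · refine (hle _).trans_eq ?_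
    simp only [hv]

end Model

section Model

variable {M : Type} [AccModel M]

/-! ### Truth values in a model -/

theorem one_ne_zero' : (1 : M) ≠ 0 := S_ne_zero 0

theorem one_sub_ne_zero {a : M} : 1 - a ≠ 0 ↔ a = 0 := by
  refine ⟨fun h => by_contra fun h' => h (one_sub_of_ne_zero h'), ?_⟩
  rintro rfl
  rw [sub_zero']
  exact one_ne_zero'

theorem one_sub_eq_zero {a : M} : 1 - a = 0 ↔ a ≠ 0 := by
  rw [← not_iff_not, not_not]; exact one_sub_ne_zero

theorem add_eq_zero' {a b : M} : a + b = 0 ↔ a = 0 ∧ b = 0 := by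
  constructor
  · intro h
    have ha := le_add_self' a b
    have hb := le_add_self' b a
    rw [h] at ha
    rw [add_comm, h] at hb
    exact ⟨le_antisymm ha (zero_le' a), le_antisymm hb (zero_le' b)⟩
  · rintro ⟨rfl, rfl⟩; exact add_zero 0

theorem mul_ne_zero' {a b : M} : a * b ≠ 0 ↔ a ≠ 0 ∧ b ≠ 0 := by
  constructor
  · intro h
    constructor <;> rintro rfl
    · exact h (zero_mul b)
    · exact h (mul_zero a)
  · rintro ⟨ha, hb⟩ h
    rw [(eq_zero_or_S b).resolve_left hb, mul_S, add_eq_zero'] at h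
    exact ha h.2

theorem one_sub_one_sub_le (a : M) : 1 - (1 - a) ≤ 1 := by
  by_cases h : a = 0
  · rw [h, sub_zero', sub_eq_zero_of_le le_rfl]; exact zero_le' 1
  · rw [one_sub_of_ne_zero h, sub_zero']

/-- Truth is read as being nonzero rather than as being `1`, so the connectives can be decoded
without bounds on their arguments. -/
theorem or_ne_zero {a b : M} : 1 - (1 - (a + b)) ≠ 0 ↔ a ≠ 0 ∨ b ≠ 0 := by
  rw [one_sub_ne_zero, one_sub_eq_zero, ne_eq, add_eq_zero', not_and_or]

theorem pos_ne_zero {a : M} : 1 - (1 - a) ≠ 0 ↔ a ≠ 0 := by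
  rw [one_sub_ne_zero, one_sub_eq_zero]

theorem eq_ne_zero {a b : M} : 1 - ((a - b) + (b - a)) ≠ 0 ↔ a = b := by
  rw [one_sub_ne_zero, add_eq_zero', sub_eq_zero_iff, sub_eq_zero_iff, ← le_antisymm_iff]

theorem eq_one_of_le {a : M} (h : a ≤ 1) (h0 : a ≠ 0) : a = 1 := by
  refine le_antisymm h ?_
  rw [(eq_zero_or_S a).resolve_left h0, S_eq, add_comm]
  exact le_add_self' _ _

theorem mul_le_one' {a b : M} (ha : a ≤ 1) (hb : b ≤ 1) : a * b ≤ 1 :=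
  (mul_mono ha hb).trans_eq (mul_one 1)

section Eval

open ElemFn

variable {n : ℕ} (xs : Fin n → M)

theorem F_app₁ (f : ElemFn 1) (a : ElemFn n) : F (app₁ f a) xs = F f ![F a xs] := by
  rw [ElemFn.app₁, F_comp]
  congr 1; funext i; fin_cases i; rfl

theorem F_app₂ (f : ElemFn 2) (a b : ElemFn n) : F (app₂ f a b) xs = F f ![F a xs, F b xs] := by
  rw [ElemFn.app₂, F_comp]
  congr 1; funext i; fin_cases i <;> rfl

theorem F_zeroF : F zeroF xs = (0 : M) := by
  rw [zeroF, F_comp]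
  change F _ _ = F _ _
  congr 1; funext i; exact i.elim0

variable (a b : ElemFn n)

theorem F_oneF : F oneF xs = (1 : M) := by rw [oneF, F_app₁, F_zeroF]; rfl
theorem F_notF : F (notF a) xs = 1 - F a xs := by rw [notF, F_app₂, F_oneF]; rfl
theorem F_posF : F (posF a) xs = 1 - (1 - F a xs) := by rw [posF, F_notF, F_notF]
theorem F_andF : F (andF a b) xs = F a xs * F b xs := by rw [andF, F_app₂]; rfl
theorem F_add : F (app₂ .add a b) xs = F a xs + F b xs := by rw [F_app₂]; rfl
theorem F_sub : F (app₂ .monus a b) xs = F a xs - F b xs := by rw [F_app₂]; rfl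
theorem F_orF : F (orF a b) xs = 1 - (1 - (F a xs + F b xs)) := by rw [orF, F_posF, F_add]
theorem F_eqF : F (eqF a b) xs = 1 - ((F a xs - F b xs) + (F b xs - F a xs)) := by
  rw [eqF, F_notF, F_add, F_sub, F_sub]
theorem F_pair : F (app₂ .pair a b) xs = pr (F a xs) (F b xs) := by rw [F_app₂]; rfl
theorem F_fst : F (app₁ .fst a) xs = fs (F a xs) := by rw [F_app₁]; rfl
theorem F_snd : F (app₁ .snd a) xs = sn (F a xs) := by rw [F_app₁]; rfl

end Eval

/-! ### The order of the notation system in a model -/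

/-- The components of a code. -/
def eA (x : M) : M := fs (x - 1)
def eB (x : M) : M := fs (sn (x - 1))
def eR (x : M) : M := sn (sn (x - 1))

/-- The code of `Ω ^ a * ϑ(b) + r`. -/
def oadd (a b r : M) : M := S (pr a (pr b r))

/-- The triple of truth values for `x` and `y`. -/
def Cmp (x y : M) : M := F .cmp ![pr x y]

/-- `x < y` -/
def Lt (x y : M) : Prop := ¬ fs (Cmp x y) = 0

/-- `∀ γ ∈ K(x), γ < ϑ(y)` -/
def AllK (x y : M) : Prop := ¬ fs (sn (Cmp x y)) = 0

/-- `∃ δ ∈ K(y), ϑ(x) ≤ δ` -/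
def ExK (x y : M) : Prop := ¬ sn (sn (Cmp x y)) = 0

/-- `ϑ(x) < ϑ(y)` -/
def ThLt (x y : M) : Prop := (Lt x y ∧ AllK x y) ∨ ExK x y

/-- `x` is the code of a term in normal form. -/
def NF (x : M) : Prop := ¬ F .nf ![x] = 0

section
open ElemFn
variable {n : ℕ} (xs : Fin n → M) (a b : ElemFn n)
theorem F_expF : F (expF a) xs = eA (F a xs) := by rw [expF, F_fst, F_sub, F_oneF]; rfl
theorem F_coeffF : F (coeffF a) xs = eB (F a xs) := by
  rw [coeffF, F_fst, F_snd, F_sub, F_oneF]; rfl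
theorem F_tailF : F (tailF a) xs = eR (F a xs) := by
  rw [tailF, F_snd, F_snd, F_sub, F_oneF]; rfl
theorem F_ltF : F (ltF a) xs = fs (F a xs) := by rw [ltF, F_fst]
theorem F_allKF : F (allKF a) xs = fs (sn (F a xs)) := by rw [allKF, F_fst, F_snd]
theorem F_exKF : F (exKF a) xs = sn (sn (F a xs)) := by rw [exKF, F_snd, F_snd]
theorem F_cmpF : F (cmpF a b) xs = Cmp (F a xs) (F b xs) := by rw [cmpF, F_app₁, F_pair]; rfl
theorem F_thetaLtF : F (thetaLtF a) xs = 1 - (1 - (fs (F a xs) * fs (sn (F a xs)) +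
    sn (sn (F a xs)))) := by
  rw [thetaLtF, F_orF, F_andF, F_ltF, F_allKF, F_exKF]
end

section
variable (a b r : M)
theorem oadd_sub_one : oadd a b r - 1 = pr a (pr b r) := by rw [oadd, ← S_zero, S_sub_S, sub_zero']
theorem eA_oadd : eA (oadd a b r) = a := by rw [eA, oadd_sub_one, fs_pr]
theorem eB_oadd : eB (oadd a b r) = b := by rw [eB, oadd_sub_one, sn_pr, fs_pr]
theorem eR_oadd : eR (oadd a b r) = r := by rw [eR, oadd_sub_one, sn_pr, sn_pr]
theorem oadd_ne_zero : oadd a b r ≠ 0 := S_ne_zero _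
theorem lt_S_of_le {a b : M} (h : a ≤ b) : a < S b := by
  rw [lt_S_iff]; exact h.lt_or_eq
theorem exp_lt_oadd : a < oadd a b r := lt_S_of_le (left_le_pr _ _)
theorem coeff_lt_oadd : b < oadd a b r :=
  lt_S_of_le ((left_le_pr _ _).trans (right_le_pr _ _))
theorem tail_lt_oadd : r < oadd a b r :=
  lt_S_of_le ((right_le_pr _ _).trans (right_le_pr _ _))
end

theorem eq_oadd {x : M} (h : x ≠ 0) : x = oadd (eA x) (eB x) (eR x) := by
  rw [oadd, eA, eB, eR, pr_fs_sn, pr_fs_sn]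
  exact (eq_zero_or_S x).resolve_left h

/-- The value of a limited recursion at an earlier argument. -/
def guarded (n m c : M) : M := (1 - (S m - n)) * c

theorem guarded_eq {n m : M} (h : m < n) (c : M) : guarded n m c = c := by
  rw [guarded, sub_eq_zero_of_le (a := S m), sub_zero', one_mul]
  rw [S_eq]; exact (lt_iff_succ_le _ _).1 h

/-- The defining recursion of the comparison function, with its limit removed: every component is
built from truth values at most `1`, so the whole is at most the triple of ones. -/
theorem Cmp_eq (x y : M) : let g := fun u w : M => guarded (pr x y) (pr u w) (Cmp u w)
    let th := fun c : M => 1 - (1 - (fs c * fs (sn c) + sn (sn c)))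
    let or := fun c d : M => 1 - (1 - (c + d))
    let eq := fun c d : M => 1 - ((c - d) + (d - c))
    Cmp x y = pr ((1 - (1 - y)) * or (1 - x) (or (fs (g (eA x) (eA y))) (eq (eA x) (eA y) *
        or (th (g (eB x) (eB y))) (eq (eB x) (eB y) * fs (g (eR x) (eR y))))))
      (pr (or (1 - x) (fs (sn (g (eA x) y)) * (th (g (eB x) y) * fs (sn (g (eR x) y)))))
        ((1 - (1 - y)) * or (sn (sn (g x (eA y))))
          (or (or (eq x (eB y)) (th (g x (eB y)))) (sn (sn (g x (eR y))))))) := by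
  intro g th or eq
  refine (F_crec (n := 0) (k := 9) _ _ _ ![pr x y] fun ys => ?_).trans ?_
  · simp only [F_pair, F_andF, F_posF, F_orF, F_oneF]
    exact pr_mono (mul_le_one' (one_sub_one_sub_le _) (one_sub_one_sub_le _))
      (pr_mono (one_sub_one_sub_le _)
        (mul_le_one' (one_sub_one_sub_le _) (one_sub_one_sub_le _)))
  · have happ : ∀ G : Fin 9 → M, Fin.append ![pr x y] G = Fin.cons (pr x y) G := fun G => by
      funext i
      refine Fin.cases rfl (fun i => ?_) i
      rw [Fin.cons_succ]
      have := Fin.append_right ![pr x y] G i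
      rw [← this]
      congr 1
      ext; simp [Nat.add_comm]
    -- Identifies each of the nine recursive calls with the guarded triple of the pair it refers to.
    have hg : ∀ (q : ElemFn 1) (u w : M), F q ![pr x y] = pr u w →
        (1 - (S (F q ![pr x y]) - pr x y)) *
          F .cmp (Fin.cons (F q ![pr x y]) (Fin.tail ![pr x y]) : Fin 1 → M) = g u w := by
      intro q u w h
      have : (Fin.cons (F q ![pr x y]) (Fin.tail ![pr x y]) : Fin 1 → M) = ![pr u w] := by
        funext i
        obtain rfl := Fin.fin_one_eq_zero i
        exact h
      rw [h] at this ⊢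
      rw [this]
      rfl
    have h0 : F (.proj 0) ![pr x y] = pr x y := F_proj _ _
    refine (congrArg (F _) (happ _)).trans
      ((congrArg (fun G => F _ (Fin.cons (pr x y) G : Fin 10 → M))
        (a₂ := ![g (eA x) (eA y), g (eB x) (eB y), g (eR x) (eR y), g (eA x) y, g (eB x) y,
          g (eR x) y, g x (eA y), g x (eB y), g x (eR y)]) ?_).trans ?_)
    · funext i
      fin_cases i <;> refine hg _ _ _ ?_ <;>
        simp [F_pair, F_expF, F_coeffF, F_tailF, F_fst, F_snd, h0, fs_pr, sn_pr]
    · simp only [F_pair, F_andF, F_posF, F_orF, F_notF, F_eqF, F_ltF, F_thetaLtF, F_allKF, F_exKF,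
        F_expF, F_coeffF, F_fst, F_snd, F_proj, Fin.cons_zero, fs_pr, sn_pr]
      rfl

theorem fs_Cmp_le_one (x y : M) : fs (Cmp x y) ≤ 1 := by
  rw [Cmp_eq, fs_pr]
  exact mul_le_one' (one_sub_one_sub_le _) (one_sub_one_sub_le _)

theorem not_Lt_zero (x : M) : ¬ Lt x 0 := by
  rw [Lt, Cmp_eq, fs_pr, not_not, sub_zero', sub_eq_zero_of_le le_rfl, zero_mul]

theorem zero_Lt {y : M} (h : y ≠ 0) : Lt 0 y := by
  rw [Lt, Cmp_eq, fs_pr, ← ne_eq, mul_ne_zero', pos_ne_zero, or_ne_zero]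
  exact ⟨h, .inl (by rw [sub_zero']; exact one_ne_zero')⟩

theorem not_ExK_zero (x : M) : ¬ ExK x 0 := by
  rw [ExK, Cmp_eq, sn_pr, sn_pr, not_not, sub_zero', sub_eq_zero_of_le le_rfl, zero_mul]

theorem one_sub_oadd (a b r : M) : 1 - oadd a b r = 0 := one_sub_of_ne_zero (oadd_ne_zero a b r)

/-- The guards of the recursion disappear because the pairs of components have smaller codes than
the pair compared. This holds for every element of the model, nonstandard codes included. -/
theorem Lt_oadd {a b r a' b' r' : M} : Lt (oadd a b r) (oadd a' b' r') ↔
    Lt a a' ∨ (a = a' ∧ (ThLt b b' ∨ (b = b' ∧ Lt r r'))) := by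
  rw [Lt, Cmp_eq, fs_pr, ← ne_eq]
  simp only [mul_ne_zero', or_ne_zero, eq_ne_zero, one_sub_oadd, eA_oadd, eB_oadd,
    eR_oadd]
  rw [guarded_eq (pr_lt_pr (exp_lt_oadd a b r).le (exp_lt_oadd a' b' r').le
      (.inl (exp_lt_oadd a b r))),
    guarded_eq (pr_lt_pr (coeff_lt_oadd a b r).le (coeff_lt_oadd a' b' r').le
      (.inl (coeff_lt_oadd a b r))),
    guarded_eq (pr_lt_pr (tail_lt_oadd a b r).le (tail_lt_oadd a' b' r').le
      (.inl (tail_lt_oadd a b r)))]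
  simp only [sub_zero', one_ne_zero', ne_eq, not_false_eq_true, true_and, not_true_eq_false,
    false_or]
  rfl

theorem AllK_oadd {a b r y : M} :
    AllK (oadd a b r) y ↔ AllK a y ∧ ThLt b y ∧ AllK r y := by
  rw [AllK, Cmp_eq, sn_pr, fs_pr, ← ne_eq]
  simp only [mul_ne_zero', or_ne_zero, one_sub_oadd, eA_oadd, eB_oadd, eR_oadd]
  rw [guarded_eq (pr_lt_pr (exp_lt_oadd a b r).le le_rfl (.inl (exp_lt_oadd a b r))),
    guarded_eq (pr_lt_pr (coeff_lt_oadd a b r).le le_rfl (.inl (coeff_lt_oadd a b r))),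
    guarded_eq (pr_lt_pr (tail_lt_oadd a b r).le le_rfl (.inl (tail_lt_oadd a b r)))]
  simp only [ne_eq, not_true_eq_false, false_or]
  rfl

theorem ExK_oadd {x a b r : M} :
    ExK x (oadd a b r) ↔ ExK x a ∨ (x = b ∨ ThLt x b) ∨ ExK x r := by
  rw [ExK, Cmp_eq, sn_pr, sn_pr, ← ne_eq]
  simp only [mul_ne_zero', or_ne_zero, eq_ne_zero, one_sub_oadd, eA_oadd, eB_oadd,
    eR_oadd]
  rw [guarded_eq (pr_lt_pr le_rfl (exp_lt_oadd a b r).le (.inr (exp_lt_oadd a b r))),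
    guarded_eq (pr_lt_pr le_rfl (coeff_lt_oadd a b r).le (.inr (coeff_lt_oadd a b r))),
    guarded_eq (pr_lt_pr le_rfl (tail_lt_oadd a b r).le (.inr (tail_lt_oadd a b r)))]
  simp only [sub_zero', one_ne_zero', ne_eq, not_false_eq_true, true_and]
  rfl

theorem nf_eq (x : M) : let g := fun u : M => guarded x u (F .nf ![u])
    let th := fun c : M => 1 - (1 - (fs c * fs (sn c) + sn (sn c)))
    let or := fun c d : M => 1 - (1 - (c + d))
    let eq := fun c d : M => 1 - ((c - d) + (d - c))
    F .nf ![x] = or (1 - x) (g (eA x) * (g (eB x) * (g (eR x) * or (1 - eR x)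
      (or (fs (Cmp (eA (eR x)) (eA x))) (eq (eA (eR x)) (eA x) *
        or (eq (eB (eR x)) (eB x)) (th (Cmp (eB (eR x)) (eB x)))))))) := by
  intro g th or eq
  refine (F_crec (n := 0) (k := 3) _ _ _ ![x] fun ys => ?_).trans ?_
  · simp only [F_orF, F_oneF]
    exact one_sub_one_sub_le _
  · have happ : ∀ G : Fin 3 → M, Fin.append ![x] G = Fin.cons x G := fun G => by
      funext i
      refine Fin.cases rfl (fun i => ?_) i
      rw [Fin.cons_succ]
      have := Fin.append_right ![x] G i
      rw [← this]
      congr 1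
      ext; simp [Nat.add_comm]
    have hg : ∀ (q : ElemFn 1) (u : M), F q ![x] = u →
        (1 - (S (F q ![x]) - x)) *
          F .nf (Fin.cons (F q ![x]) (Fin.tail ![x]) : Fin 1 → M) = g u := by
      intro q u h
      have : (Fin.cons (F q ![x]) (Fin.tail ![x]) : Fin 1 → M) = ![u] := by
        funext i
        obtain rfl := Fin.fin_one_eq_zero i
        exact h
      rw [h] at this ⊢
      rw [this]
      rfl
    have h0 : F (.proj 0) ![x] = x := F_proj _ _
    refine (congrArg (F _) (happ _)).trans
      ((congrArg (fun G => F _ (Fin.cons x G : Fin 4 → M))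
        (a₂ := ![g (eA x), g (eB x), g (eR x)]) ?_).trans ?_)
    · funext i
      fin_cases i <;> refine hg _ _ ?_ <;>
        simp [F_expF, F_coeffF, F_tailF, h0]
    · simp only [F_andF, F_orF, F_notF, F_eqF, F_ltF, F_thetaLtF, F_cmpF,
        F_expF, F_coeffF, F_tailF, F_proj, Fin.cons_zero]
      rfl

theorem F_nf_le_one (x : M) : F .nf ![x] ≤ 1 := by
  rw [nf_eq]; exact one_sub_one_sub_le _

theorem NF_zero : NF (0 : M) := by
  rw [NF, nf_eq, ← ne_eq, or_ne_zero]
  exact .inl (by rw [sub_zero']; exact one_ne_zero')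

theorem NF_oadd {a b r : M} : NF (oadd a b r) ↔ NF a ∧ NF b ∧ NF r ∧
    (r = 0 ∨ Lt (eA r) a ∨ (eA r = a ∧ (eB r = b ∨ ThLt (eB r) b))) := by
  rw [NF, nf_eq, ← ne_eq]
  simp only [mul_ne_zero', or_ne_zero, eq_ne_zero, one_sub_oadd, eA_oadd, eB_oadd, eR_oadd]
  rw [guarded_eq (exp_lt_oadd a b r), guarded_eq (coeff_lt_oadd a b r),
    guarded_eq (tail_lt_oadd a b r), one_sub_ne_zero]
  simp only [ne_eq, not_true_eq_false, false_or]
  rfl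

/-- `Prec` asks for the value `1` exactly, whence the bounds by `1` on the three truth values. -/
theorem Prec_iff {x y : M} : Prec x y ↔ NF x ∧ NF y ∧ Lt x y := by
  have hnf : ∀ i : Fin 2, F (ElemFn.app₁ .nf (.proj i)) ![x, y] = F .nf ![![x, y] i] :=
    fun i => by rw [F_app₁, F_proj]
  have : F .prec ![x, y] = F .nf ![x] * F .nf ![y] * fs (Cmp x y) := by
    rw [ElemFn.prec, F_andF, F_andF, F_ltF, F_cmpF, hnf, hnf, F_proj, F_proj]
    rfl
  rw [Prec, this, S_zero]
  constructor
  · intro h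
    have h₁ : F .nf ![x] * F .nf ![y] * fs (Cmp x y) ≠ 0 := by rw [h]; exact one_ne_zero'
    rw [mul_ne_zero', mul_ne_zero'] at h₁
    exact ⟨h₁.1.1, h₁.1.2, h₁.2⟩
  · rintro ⟨hx, hy, h⟩
    rw [eq_one_of_le (F_nf_le_one x) hx, eq_one_of_le (F_nf_le_one y) hy,
      eq_one_of_le (fs_Cmp_le_one x y) h, mul_one, mul_one]

/-! ### Definability and induction for the accessible part -/

section
variable (s t u : M → M → M) [TermDef s] [TermDef t] [TermDef u]

instance : TermDef (fun x y => oadd (s x y) (t x y) (u x y)) :=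
  TermDef.succ (fun x y => pr (s x y) (pr (t x y) (u x y)))
instance : TermDef (fun x y => eA (s x y)) := TermDef.fs (fun x y => s x y - 1)
instance : TermDef (fun x y => eR (s x y)) := TermDef.sn (fun x y => sn (s x y - 1))
instance : TermDef (fun x y => Cmp (s x y) (t x y)) :=
  TermDef.app₁ .cmp (fun x y => pr (s x y) (t x y))
-- The order relations are characteristic functions of the language, so statements about them need
-- no quantifiers.
instance : QFDef (fun x y => Lt (s x y) (t x y)) :=
  QFDef.not (fun x y => fs (Cmp (s x y) (t x y)) = 0)
instance : QFDef (fun x y => ExK (s x y) (t x y)) :=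
  QFDef.not (fun x y => sn (sn (Cmp (s x y) (t x y))) = 0)
instance : QFDef (fun x y => NF (s x y)) := QFDef.not (fun x y => F .nf ![s x y] = 0)
instance : QFDef (fun x y => Prec (s x y) (t x y)) := QFDef.eq (fun x y => F .prec ![s x y, t x y]) _
end

theorem strong_induction (P : M → Prop) [QFDef fun x _ => P x]
    (h : ∀ x, (∀ z, z < x → P z) → P x) (x : M) : P x :=
  h x (strong_induction_aux P (fun z hz => (not_lt_zero' z hz).elim)
    (fun x ih z hz => ((lt_S_iff z x).1 hz).elim (ih z) fun e => e ▸ h x ih) x)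

/-- Course-of-values induction for `C(x) → x ∈ W`. -/
theorem W_code_induction (C : M → Prop) [QFDef fun _ y => C y]
    (h : ∀ x, C x → (∀ z, z < x → C z → W z) → W x) (x : M) (hx : C x) : W x := by
  -- Collecting all codes below `n` reduces course-of-values induction to successor induction for an
  -- `Acc` formula; the value at `x` is read off at `S x`.
  have key := acc_induction accPrec (fun n y => y < n ∧ C y)
    (fun y hy => (not_lt_zero' y hy.1).elim)
    (fun n ih y hy => ((lt_S_iff y n).1 hy.1).elim (fun hn => ih y ⟨hn, hy.2⟩) fun e => by
      subst e
      exact h y hy.2 fun z hz hz' => ih z ⟨hz, hz'⟩) (S x)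
  exact key x ⟨(lt_S_iff x x).2 (.inr rfl), hx⟩

/-- Induction along the accessible part for `C(x) → t(x) ∈ W`. -/
theorem W_induction (C : M → Prop) (t : M → M) [QFDef fun x _ => C x] [TermDef fun x _ => t x]
    (h : ∀ x, W x → C x → (∀ z, Prec z x → C z → W (t z)) → W (t x)) {x : M} (hx : W x)
    (hC : C x) : W (t x) := by
  -- The disjunction packs `x ∈ W` and `C(x) → t(x) ∈ W` into one `Acc` formula, so the induction
  -- step may also use `x ∈ W`.
  refine W_induction_aux (fun x y => y = x ∨ (C x ∧ y = t x)) (fun x ih => ?_) hx _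
    (.inr ⟨hC, rfl⟩)
  have hW : W x := W_of_forall_prec fun z hz => ih z hz z (.inl rfl)
  rintro y (rfl | ⟨hC, rfl⟩)
  · exact hW
  · exact h x hW hC fun z hz hC => ih z hz _ (.inr ⟨hC, rfl⟩)

/-- Induction on `x ∈ W` for the claim that all predecessors of `x` are in `W`. For `y` below `x`
the hypothesis covers everything below `y`, so closure gives `y ∈ W`, and transitivity of the order
is not needed. -/
theorem W_of_prec {x y : M} (hx : W x) (h : Prec y x) : W y := by
  refine W_induction_aux (fun x y => Prec y x) (fun x ih y hy => ?_) hx y h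
  exact W_of_forall_prec fun z hz => ih y hy z hz

end Model

section Model

variable {M : Type} [AccModel M]

/-! ### The ordinals below `ϑ(Ω * k)` are accessible -/

/-- The code of `ϑ(b)`. -/
@[reducible] def th (b : M) : M := oadd 0 b 0

/-- The code of `Ω * k + β`. -/
def omegaAdd : ℕ → M → M
  | 0, β => β
  | k + 1, β => oadd (th 0) 0 (omegaAdd k β)

/-- `β` is the code of a term in normal form that denotes a countable ordinal. -/
@[reducible] def Ctbl (β : M) : Prop := NF β ∧ (β = 0 ∨ eA β = 0)

theorem not_ThLt_zero (b : M) : ¬ ThLt b 0 := by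
  rintro (⟨h, -⟩ | h)
  · exact not_Lt_zero _ h
  · exact not_ExK_zero _ h

/-- No exponent is below `0`, so the comparison is decided by the coefficient or by the tail. -/
theorem eq_of_Lt_oadd_zero {x b r : M} (h : Lt x (oadd 0 b r)) :
    x = 0 ∨ ∃ b' r', x = oadd 0 b' r' ∧ (ThLt b' b ∨ (b' = b ∧ Lt r' r)) := by
  by_cases hx : x = 0
  · exact .inl hx
  · rw [eq_oadd hx, Lt_oadd] at h
    rcases h with h | ⟨h₁, h⟩
    · exact (not_Lt_zero _ h).elim
    · exact .inr ⟨eB x, eR x, by rw [← h₁]; exact eq_oadd hx, h⟩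

theorem Ctbl_zero : Ctbl (0 : M) := ⟨NF_zero, .inl rfl⟩

theorem Ctbl.eq_oadd {x : M} (h : Ctbl x) (hx : x ≠ 0) : x = oadd 0 (eB x) (eR x) := by
  have := WeakID.eq_oadd hx
  rwa [h.2.resolve_left hx] at this

theorem Ctbl_oadd {b r : M} : Ctbl (oadd 0 b r) ↔ NF b ∧ Ctbl r ∧
    (r = 0 ∨ eB r = b ∨ ThLt (eB r) b) := by
  rw [Ctbl, NF_oadd, eA_oadd]
  constructor
  · rintro ⟨⟨-, hb, hr, h⟩, -⟩
    rcases h with rfl | h | ⟨h, h'⟩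
    · exact ⟨hb, Ctbl_zero, .inl rfl⟩
    · exact (not_Lt_zero _ h).elim
    · exact ⟨hb, ⟨hr, .inr h⟩, .inr h'⟩
  · rintro ⟨hb, hr, h⟩
    refine ⟨⟨NF_zero, hb, hr.1, ?_⟩, .inr rfl⟩
    rcases hr.2 with h₁ | h₁
    · exact .inl h₁
    · exact h.imp_right fun h => .inr ⟨h₁, h⟩

theorem Ctbl_th {b : M} (h : NF b) : Ctbl (th b) := Ctbl_oadd.2 ⟨h, Ctbl_zero, .inl rfl⟩

theorem NF_th {b : M} (h : NF b) : NF (th b) := (Ctbl_th h).1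

/-- By normal form the first summand of the tail is smaller than that of `x` or equal to it; in the
latter case the claim passes to the tail, whose code is smaller. -/
theorem tail_Lt (x : M) : Ctbl x → ¬ x = 0 → Lt (eR x) x := by
  refine strong_induction (fun x => Ctbl x → ¬ x = 0 → Lt (eR x) x) (fun x ih h hx => ?_) x
  have e := h.eq_oadd hx
  generalize eB x = b at e
  generalize eR x = r at e ⊢
  subst e
  obtain ⟨-, hr, h⟩ := Ctbl_oadd.1 h
  rcases eq_or_ne r 0 with rfl | hr0
  · exact zero_Lt (oadd_ne_zero _ _ _)
  · have h₁ := ih r (tail_lt_oadd _ _ _) hr hr0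
    conv_lhs => rw [hr.eq_oadd hr0]
    rw [Lt_oadd]
    exact .inr ⟨rfl, (h.resolve_left hr0).symm.imp_right fun h => ⟨h, h₁⟩⟩

theorem W_zero : W (0 : M) :=
  W_of_forall_prec fun y hy => (not_Lt_zero y (Prec_iff.1 hy).2.2).elim

theorem W_th_zero : W (th (0 : M)) := by
  refine W_of_forall_prec fun y hy => ?_
  rcases eq_of_Lt_oadd_zero (Prec_iff.1 hy).2.2 with rfl | ⟨b, r, rfl, h | ⟨-, h⟩⟩
  · exact W_zero
  · exact (not_ThLt_zero _ h).elim
  · exact (not_Lt_zero _ h).elim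

/-- Induction along `W` on `r`. A predecessor with a smaller first summand is already below `ϑ(b)`,
whatever its tail; one with the same first summand has a smaller tail. -/
theorem W_oadd {b r : M} (hb : W (th b)) (hr : W r) (h : NF (oadd 0 b r)) : W (oadd 0 b r) := by
  refine W_induction (fun r => NF (oadd 0 b r)) (fun r => oadd 0 b r)
    (fun r _ h ih => W_of_forall_prec fun y hy => ?_) hr h
  obtain ⟨hN, -, hlt⟩ := Prec_iff.1 hy
  rcases eq_of_Lt_oadd_zero hlt with rfl | ⟨b', r', rfl, h' | ⟨rfl, h'⟩⟩
  · exact W_zero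
  · exact W_of_prec hb (Prec_iff.2 ⟨hN, NF_th (NF_oadd.1 h).2.1, Lt_oadd.2 (.inr ⟨rfl, .inl h'⟩)⟩)
  · exact ih r' (Prec_iff.2 ⟨(NF_oadd.1 hN).2.2.1, (NF_oadd.1 h).2.2.1, h'⟩) hN

/-- For countable `β`, the elements of `K(β)` are its summands. If `ϑ(b)` is at most the first one,
it is at most `β`; otherwise one passes to the tail, which is below `β`. The induction along `W`
replaces an appeal to transitivity. -/
theorem W_th_of_ExK {b β : M} (hb : NF b) (hβ : W β) (h : Ctbl β) (h' : ExK b β) : W (th b) := by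
  refine W_induction (fun β => Ctbl β ∧ ExK b β) (fun _ => th b) (fun β hβ h ih => ?_) hβ ⟨h, h'⟩
  obtain ⟨h, h'⟩ := h
  have h0 : β ≠ 0 := by rintro rfl; exact not_ExK_zero _ h'
  have htail := tail_Lt β h h0
  have e := h.eq_oadd h0
  generalize eB β = b' at e
  generalize eR β = r at e htail
  subst e
  obtain ⟨-, hr, -⟩ := Ctbl_oadd.1 h
  have hth := NF_th hb
  rcases ExK_oadd.1 h' with h₁ | (rfl | h₁) | h₁
  · exact (not_ExK_zero _ h₁).elim
  · rcases eq_or_ne r 0 with rfl | hr0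
    · exact hβ
    · exact W_of_prec hβ (Prec_iff.2 ⟨hth, h.1, Lt_oadd.2 (.inr ⟨rfl, .inr ⟨rfl, zero_Lt hr0⟩⟩)⟩)
  · exact W_of_prec hβ (Prec_iff.2 ⟨hth, h.1, Lt_oadd.2 (.inr ⟨rfl, .inl h₁⟩)⟩)
  · exact ih r (Prec_iff.2 ⟨hr.1, h.1, htail⟩) ⟨hr, h₁⟩

theorem eq_zero_of_Lt_one {a : M} (h : Lt a (th 0)) : a = 0 := by
  rcases eq_of_Lt_oadd_zero h with rfl | ⟨b', r', rfl, h' | ⟨-, h'⟩⟩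
  · rfl
  · exact (not_ThLt_zero _ h').elim
  · exact (not_Lt_zero _ h').elim

/-- The leading exponent of `b` is below `1`, hence `0`, and `b` is countable; or it equals `1`, and
then the coefficient is `1` too, as nothing is below `ϑ(0)` among the terms `ϑ(·)`. The second case
strips one `Ω` from both sides. The number `j` is standard because `k` is. -/
theorem eq_omegaAdd_of_Lt {β : M} (hβ : Ctbl β) : ∀ (k : ℕ) {b : M}, NF b →
    Lt b (omegaAdd k β) → ∃ j β', b = omegaAdd j β' ∧ Ctbl β' ∧ (j < k ∨ (j = k ∧ Lt β' β))
  | 0, b, hb, h => by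
    refine ⟨0, b, rfl, ⟨hb, ?_⟩, .inr ⟨rfl, h⟩⟩
    have h0 : β ≠ 0 := by rintro rfl; exact not_Lt_zero _ h
    rw [omegaAdd, hβ.eq_oadd h0] at h
    rcases eq_of_Lt_oadd_zero h with rfl | ⟨b', r', rfl, -⟩
    · exact .inl rfl
    · exact .inr (eA_oadd _ _ _)
  | k + 1, b, hb, h => by
    rcases eq_or_ne b 0 with rfl | h0
    · exact ⟨0, 0, rfl, Ctbl_zero, .inl k.succ_pos⟩
    · have e := eq_oadd h0
      rw [omegaAdd, e, Lt_oadd] at h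
      rcases h with h | ⟨h₁, h | ⟨h₂, h⟩⟩
      · exact ⟨0, b, rfl, ⟨hb, .inr (eq_zero_of_Lt_one h)⟩, .inl k.succ_pos⟩
      · exact (not_ThLt_zero _ h).elim
      · rw [e] at hb
        obtain ⟨j, β', h₃, h₄, h₅⟩ := eq_omegaAdd_of_Lt hβ k (NF_oadd.1 hb).2.2.1 h
        refine ⟨j + 1, β', ?_, h₄, h₅.imp (fun h => by omega) fun h => ⟨by omega, h.2⟩⟩
        rw [e, h₁, h₂, h₃]
        rfl

theorem AllK_of_omegaAdd {β y : M} : ∀ j : ℕ, AllK (omegaAdd j β) y → AllK β y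
  | 0, h => h
  | j + 1, h => AllK_of_omegaAdd j (AllK_oadd.1 h).2.2

/-- Here `≤` compares codes as numbers, for use in the induction on codes. -/
theorem le_omegaAdd (β : M) : ∀ j : ℕ, β ≤ omegaAdd j β
  | 0 => le_rfl
  | j + 1 => (le_omegaAdd β j).trans (tail_lt_oadd _ _ _).le

theorem NF_omegaAdd {β : M} (h : Ctbl β) : ∀ k : ℕ, NF (omegaAdd k β)
  | 0 => h.1
  | k + 1 => by
    refine NF_oadd.2 ⟨NF_th NF_zero, NF_zero, NF_omegaAdd h k, ?_⟩
    cases k with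
    | zero =>
      refine h.2.imp_right fun h => .inl ?_
      rw [omegaAdd, h]
      exact zero_Lt (oadd_ne_zero _ _ _)
    | succ k =>
      rw [omegaAdd, eA_oadd, eB_oadd]
      exact .inr (.inr ⟨rfl, .inl rfl⟩)

/-- Beyond `K(β)`, the summands `Ω` contribute only `1 = ϑ(0)`, and `ϑ(b) ≤ ϑ(0)` forces `b = 0`. -/
theorem ExK_omegaAdd {b β : M} : ∀ k : ℕ, ExK b (omegaAdd k β) → b = 0 ∨ ExK b β
  | 0, h => .inr h
  | k + 1, h => by
    rcases ExK_oadd.1 h with h | (h | h) | h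
    · rcases ExK_oadd.1 h with h | (h | h) | h
      · exact (not_ExK_zero _ h).elim
      · exact .inl h
      · exact (not_ThLt_zero _ h).elim
      · exact (not_ExK_zero _ h).elim
    · exact .inl h
    · exact (not_ThLt_zero _ h).elim
    · exact ExK_omegaAdd k h

/-- For each standard `k` this is a term of the language, so `β ↦ ϑ(Ω·k + β)` can be used in the
induction along `W`. -/
instance (k : ℕ) (s : M → M → M) [TermDef s] : TermDef (fun x y => omegaAdd k (s x y)) := by
  induction k with
  | zero => assumption
  | succ k ih =>
    exact inferInstanceAs (TermDef (fun x y => oadd (th 0) 0 (omegaAdd k (s x y))))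

/-- The leading summand of `β` belongs to `K(β)` and alone decides the lexicographic comparison. -/
theorem Lt_th_of_AllK {β x : M} (hβ : Ctbl β) (h : AllK β x) : Lt β (th x) := by
  rcases eq_or_ne β 0 with rfl | h0
  · exact zero_Lt (oadd_ne_zero _ _ _)
  · rw [hβ.eq_oadd h0, AllK_oadd] at h
    rw [hβ.eq_oadd h0, Lt_oadd]
    exact .inr ⟨rfl, .inl h.2.1⟩

/-- The accessible part is closed under `β ↦ ϑ(Ω * k + β)` for countable `β`. -/
theorem W_th_omegaAdd (k : ℕ) {β : M} (hβ : W β) (h : Ctbl β) : W (th (omegaAdd k β)) := by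
  induction k using Nat.strong_induction_on generalizing β with
  | _ k ihk =>
  refine W_induction (fun β => Ctbl β) (fun β => th (omegaAdd k β)) (fun β hβ h ih => ?_) hβ h
  have hNF := NF_omegaAdd h k
  refine W_of_forall_prec fun δ hδ => ?_
  -- The induction on codes stays below the fixed `ϑ(Ω·k + β)`, so its hypothesis applies only to
  -- terms that are both predecessors and smaller as codes.
  refine W_code_induction (fun δ => Prec δ (th (omegaAdd k β))) (fun δ hδ ihδ => ?_) δ hδ
  obtain ⟨hδ, -, hlt⟩ := Prec_iff.1 hδ
  rcases eq_of_Lt_oadd_zero hlt with rfl | ⟨b, r, rfl, hb | ⟨-, h'⟩⟩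
  · exact W_zero
  · have hδ' : Ctbl (oadd 0 b r) := ⟨hδ, .inr (eA_oadd _ _ _)⟩
    obtain ⟨hbNF, hr, hhead⟩ := Ctbl_oadd.1 hδ'
    have hWb : W (th b) := by
      rcases hb with ⟨hb, hK⟩ | hb
      · obtain ⟨j, β', rfl, hβ', hj⟩ := eq_omegaAdd_of_Lt h k hbNF hb
        -- Accessibility of `β'` itself must be secured before either of the other two hypotheses
        -- can be used for `j < k`; it comes from the condition on `K(b)`.
        have hWβ' : W β' := ihδ β' ((le_omegaAdd β' j).trans_lt (coeff_lt_oadd _ _ _))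
          (Prec_iff.2 ⟨hβ'.1, NF_th hNF, Lt_th_of_AllK hβ' (AllK_of_omegaAdd j hK)⟩)
        rcases hj with hj | ⟨rfl, hj⟩
        · exact ihk j hj hWβ' hβ'
        · exact ih β' (Prec_iff.2 ⟨hβ'.1, h.1, hj⟩) hβ'
      · rcases ExK_omegaAdd k hb with rfl | hb
        · exact W_th_zero
        · exact W_th_of_ExK hbNF hβ h hb
    have hWr : W r := by
      rcases eq_or_ne r 0 with rfl | hr0
      · exact W_zero
      -- If `r` starts with `ϑ(b)` again, it is below `ϑ(Ω·k + β)` for the same reason as `δ` and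
      -- has a smaller code; otherwise `r` is below `ϑ(b)`, already known to be accessible.
      · rcases hhead.resolve_left hr0 with hh | hh
        · refine ihδ r (tail_lt_oadd _ _ _) (Prec_iff.2 ⟨hr.1, NF_th hNF, ?_⟩)
          rw [hr.eq_oadd hr0, hh, Lt_oadd]
          exact .inr ⟨rfl, .inl hb⟩
        · refine W_of_prec hWb (Prec_iff.2 ⟨hr.1, NF_th hbNF, ?_⟩)
          rw [hr.eq_oadd hr0, Lt_oadd]
          exact .inr ⟨rfl, .inl hh⟩
    exact W_oadd hWb hWr hδ
  · exact (not_Lt_zero _ h').elim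

theorem realize_quote_oadd (a b r : OT) (v : ℕ → M) : (OT.oadd a b r).quote.realize v =
    oadd (a.quote.realize v) (b.quote.realize v) (r.quote.realize v) := by
  rw [OT.quote, realize_succT, realize_pairT, realize_pairT]
  rfl

theorem realize_quote_zero (v : ℕ → M) : OT.zero.quote.realize v = (0 : M) := realize_zeroT v

theorem realize_quote_omegaMul (v : ℕ → M) :
    ∀ k : ℕ, (OT.omegaMul k).quote.realize v = (omegaAdd k 0 : M)
  | 0 => realize_quote_zero v
  | k + 1 => by
    rw [OT.omegaMul, OT.one, OT.theta, realize_quote_oadd, realize_quote_oadd, realize_quote_zero,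
      realize_quote_omegaMul v k]
    rfl

end Model

end WeakID

theorem lemma2p1 (k : ℕ) :
    WeakID.Provable WeakID.AccID
      (WeakID.allVar 0
        (WeakID.precA (WeakID.v 0) (WeakID.OT.quote (WeakID.OT.theta (WeakID.OT.omegaMul k))) ⟹
          WeakID.inW (WeakID.v 0))) := by
  refine WeakID.provable_of_forall_accModel fun M _ v => ?_
  rw [WeakID.realize_allVar]
  intro a
  rw [Formula.realize_imp, WeakID.realize_precA, WeakID.realize_inW, WeakID.realize_v,
    Function.update_self, WeakID.OT.theta, WeakID.realize_quote_oadd, WeakID.realize_quote_zero,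
    WeakID.realize_quote_omegaMul]
  -- The term for `Ω·k` denotes `Ω·k + 0`, so the case `β = 0` applies.
  exact fun h => WeakID.W_of_prec (WeakID.W_th_omegaAdd k WeakID.W_zero WeakID.Ctbl_zero) h
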